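/- Let $X$ be a compact complex manifold of dimension $n$, let $p:\tilde X\to X$ be its universal cover, and suppose that $\tilde X$ is biholomorphic to $C^n$, where $C=\mathbb P^1$ or $C=\mathbb H$ (the upper half-plane). Then $X$ admits a semispecial tensor, that is, a nonzero section $$0\neq\omega\in H^0\big(X,S^n\Omega^1_X(-K_X)\otimes\eta\big),\qquad \eta \text{ a holomorphic line bundle with } \eta\otimes\eta\cong\mathcal O_X .$$ More precisely, fix a biholomorphism $\Phi:C^n\to\tilde X$ and let $q=p\circ\Phi:C^n\to X$. On $C^n$ let $$\tilde\omega=\frac{dz_1\otimes\dots\otimes dz_n}{dz_1\wedge\dots\wedge dz_n},$$ the section of $S^n\Omega^1_{C^n}(-K_{C^n})$ given by this formula in the standard coordinates of $\mathbb H^n$, respectively of $\mathbb C^n\subset(\mathbb P^1)^n$; in the latter case it extends holomorphically to $(\mathbb P^1)^n$, and it is given by the same formula in any product of local coordinates of the factors (the numerator denotes the image of the tensor in the symmetric power). Then the semispecial tensor $(\eta,\omega)$ can be chosen so that it is descended from $\tilde\omega$, with $\eta$ the line bundle associated to the sign character: there is a nowhere vanishing holomorphic section $e$ of $q^*\eta$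 such that 1. $q^*\omega=\tilde\omega\otimes e$; 2. for every automorphism $g\in\operatorname{Aut}(C^n)$ with $q\circ g=q$ there are a permutation $\sigma\in\mathfrak S_n$ and $h_1,\dots,h_n\in\operatorname{Aut}(C)$ such that $g(y)_i=h_i(y_{\sigma(i)})$ for all $y\in C^n$ and all $i$, and $e(g(y))=\operatorname{sgn}(\sigma)\,e(y)$ in $\eta_{q(y)}$ for all $y\in C^n$. -/

import Mathlib

open scoped Manifold ContDiff Topology TensorProduct
open Filter

/-! ### The Riemann sphere as a complex curve -/

/-- The complex projective line `ℙ¹ = ℂ ∪ {∞}`. -/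
abbrev RiemannSphere : Type := OnePoint ℂ

namespace RiemannSphere

/-- The map `z ↦ 1 / z`, exchanging `0` and `∞`. -/
noncomputable def inversion : RiemannSphere → RiemannSphere
  | OnePoint.infty => ((0 : ℂ) : OnePoint ℂ)
  | OnePoint.some z => if z = 0 then OnePoint.infty else ((z⁻¹ : ℂ) : OnePoint ℂ)

@[simp] theorem inversion_infty :
    inversion OnePoint.infty = ((0 : ℂ) : OnePoint ℂ) := rfl

@[simp] theorem inversion_zero :
    inversion ((0 : ℂ) : OnePoint ℂ) = OnePoint.infty := if_pos rfl

theorem inversion_coe {z : ℂ} (hz : z ≠ 0) :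
    inversion (z : OnePoint ℂ) = ((z⁻¹ : ℂ) : OnePoint ℂ) := if_neg hz

theorem inversion_involutive : Function.Involutive inversion := by
  intro x
  induction x using OnePoint.rec with
  | infty => simp
  | coe z =>
    by_cases hz : z = 0
    · subst hz; simp
    · rw [inversion_coe hz, inversion_coe (inv_ne_zero hz), inv_inv]

theorem continuous_inversion : Continuous inversion := by
  rw [OnePoint.continuous_iff]
  constructor
  · rw [inversion_infty, coclosedCompact_eq_cocompact, ← Metric.cobounded_eq_cocompact]
    have h : Tendsto (fun z : ℂ => ((z⁻¹ : ℂ) : OnePoint ℂ)) (Bornology.cobounded ℂ)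
        (𝓝 ((0 : ℂ) : OnePoint ℂ)) :=
      (OnePoint.continuous_coe.tendsto 0).comp tendsto_inv₀_cobounded
    refine h.congr' ?_
    filter_upwards [Bornology.eventually_ne_cobounded (0 : ℂ)] with z hz
    exact (inversion_coe hz).symm
  · rw [continuous_iff_continuousAt]
    intro z
    by_cases hz : z = 0
    · subst hz
      refine continuousAt_of_tendsto_nhds (y := OnePoint.infty) ?_
      rw [← nhdsNE_sup_pure, tendsto_sup]
      constructor
      · have h : Tendsto (fun z : ℂ => ((z⁻¹ : ℂ) : OnePoint ℂ)) (𝓝[≠] 0)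
            (𝓝 OnePoint.infty) := by
          refine OnePoint.tendsto_coe_infty.comp ?_
          rw [coclosedCompact_eq_cocompact, ← Metric.cobounded_eq_cocompact]
          exact tendsto_inv₀_nhdsNE_zero
        refine h.congr' ?_
        filter_upwards [self_mem_nhdsWithin] with w hw
        exact (inversion_coe hw).symm
      · rw [tendsto_pure_left]
        intro s hs
        simpa using mem_of_mem_nhds hs
    · have h : ContinuousAt (fun z : ℂ => ((z⁻¹ : ℂ) : OnePoint ℂ)) z :=
        OnePoint.continuous_coe.continuousAt.comp (continuousAt_inv₀ hz)
      refine h.congr ?_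
      filter_upwards [isOpen_ne.mem_nhds hz] with w hw
      exact (inversion_coe hw).symm

/-- The map `z ↦ 1 / z` as a homeomorphism of the Riemann sphere. -/
noncomputable def inversionHomeomorph : RiemannSphere ≃ₜ RiemannSphere where
  toEquiv := inversion_involutive.toPerm
  continuous_toFun := continuous_inversion
  continuous_invFun := continuous_inversion

/-- The affine chart `z` on `ℂ ⊂ ℙ¹`. -/
noncomputable def affineChart : OpenPartialHomeomorph RiemannSphere ℂ :=
  (OnePoint.isOpenEmbedding_coe.toOpenPartialHomeomorph ((↑) : ℂ → OnePoint ℂ)).symm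

/-- The chart `1 / z` on `ℙ¹ \ {0}`. -/
noncomputable def inftyChart : OpenPartialHomeomorph RiemannSphere ℂ :=
  inversionHomeomorph.toOpenPartialHomeomorph.trans affineChart

theorem affineChart_source : affineChart.source = Set.range ((↑) : ℂ → OnePoint ℂ) := by
  simp [affineChart]

theorem infty_mem_inftyChart_source : (OnePoint.infty : RiemannSphere) ∈ inftyChart.source := by
  have h : inversionHomeomorph OnePoint.infty = ((0 : ℂ) : OnePoint ℂ) := rfl
  simp [inftyChart, affineChart_source, h]

open Classical in
/-- The complex structure of the Riemann sphere, with the two charts `z` and `1 / z`. The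
preferred chart at every `z ≠ ∞` is the affine chart. -/
noncomputable instance : ChartedSpace ℂ RiemannSphere where
  atlas := {affineChart, inftyChart}
  chartAt x := if x = OnePoint.infty then inftyChart else affineChart
  mem_chart_source x := by
    by_cases hx : x = OnePoint.infty
    · subst hx; simpa using infty_mem_inftyChart_source
    · rw [if_neg hx, affineChart_source]
      exact OnePoint.ne_infty_iff_exists.1 hx
  chart_mem_atlas x := by
    by_cases hx : x = OnePoint.infty <;> simp [hx]

theorem affineChart_symm_apply (z : ℂ) : affineChart.symm z = (z : OnePoint ℂ) := rfl

theorem affineChart_coe (z : ℂ) : affineChart (z : OnePoint ℂ) = z := by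
  rw [← affineChart_symm_apply]
  exact affineChart.right_inv (by simp [affineChart])

theorem inftyChart_apply (x : RiemannSphere) : inftyChart x = affineChart (inversion x) := rfl

theorem inftyChart_symm_apply (z : ℂ) : inftyChart.symm z = inversion (z : OnePoint ℂ) := rfl

instance : IsManifold 𝓘(ℂ, ℂ) ω RiemannSphere := by
  refine isManifold_of_contDiffOn _ _ _ ?_
  have hinv : ContDiffOn ℂ ω (fun z : ℂ => z⁻¹) {0}ᶜ := fun z hz =>
    (contDiffAt_inv ℂ (by simpa using hz)).contDiffWithinAt
  rintro e e' (rfl | rfl) (rfl | rfl)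
  · exact contDiffOn_id.congr fun z _ => by simp [affineChart_symm_apply, affineChart_coe]
  · have hz : ∀ z ∈ (𝓘(ℂ, ℂ).symm ⁻¹' (affineChart.symm ≫ₕ inftyChart).source ∩
        Set.range 𝓘(ℂ, ℂ)), z ≠ 0 := by
      rintro z ⟨hz, -⟩ rfl
      simp only [OpenPartialHomeomorph.trans_source, Set.mem_preimage, Set.mem_inter_iff,
        inftyChart, affineChart_source] at hz
      obtain ⟨y, hy⟩ := hz.2.2
      exact OnePoint.coe_ne_infty y (hy.trans inversion_zero)
    refine (hinv.mono fun z h => hz z h).congr fun z h => ?_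
    simp [affineChart_symm_apply, inftyChart_apply, inversion_coe (hz z h), affineChart_coe]
  · have hz : ∀ z ∈ (𝓘(ℂ, ℂ).symm ⁻¹' (inftyChart.symm ≫ₕ affineChart).source ∩
        Set.range 𝓘(ℂ, ℂ)), z ≠ 0 := by
      rintro z ⟨hz, -⟩ rfl
      simp only [OpenPartialHomeomorph.trans_source, Set.mem_preimage, Set.mem_inter_iff,
        affineChart_source] at hz
      obtain ⟨y, hy⟩ := hz.2
      exact OnePoint.coe_ne_infty y (hy.trans inversion_zero)
    refine (hinv.mono fun z h => hz z h).congr fun z h => ?_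
    simp [inftyChart_symm_apply, inversion_coe (hz z h), affineChart_coe]
  · refine contDiffOn_id.congr fun z _ => ?_
    simp [inftyChart_symm_apply, inftyChart_apply, inversion_involutive _, affineChart_coe]

end RiemannSphere

/-! ### Line bundles and twisted symmetric tensors -/

section Bundles

variable (n : ℕ) (X : Type*) [TopologicalSpace X] [ChartedSpace (Fin n → ℂ) X]

/-- A holomorphic line bundle on the complex manifold `X` of dimension `n`. -/
structure HolomorphicLineBundle where
  /-- The fibre over a point. -/
  Fiber : X → Type
  [addCommGroup : ∀ x, AddCommGroup (Fiber x)]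
  [module : ∀ x, Module ℂ (Fiber x)]
  [topologicalSpace : ∀ x, TopologicalSpace (Fiber x)]
  [totalSpace : TopologicalSpace (Bundle.TotalSpace ℂ Fiber)]
  [fiberBundle : FiberBundle ℂ Fiber]
  [vectorBundle : VectorBundle ℂ ℂ Fiber]
  [holomorphic : ContMDiffVectorBundle ω ℂ Fiber 𝓘(ℂ, Fin n → ℂ)]

attribute [instance] HolomorphicLineBundle.addCommGroup HolomorphicLineBundle.module
  HolomorphicLineBundle.topologicalSpace HolomorphicLineBundle.totalSpace
  HolomorphicLineBundle.fiberBundle HolomorphicLineBundle.vectorBundle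
  HolomorphicLineBundle.holomorphic

variable {n X}

/-- `η ⊗ η ≅ 𝒪_X`: there are isomorphisms `ψ x : η_x ⊗ η_x ≃ ℂ` depending holomorphically on
`x`, i.e. given by holomorphic functions in local trivialisations of `η`. -/
def HolomorphicLineBundle.IsTwoTorsion (η : HolomorphicLineBundle n X) : Prop :=
  ∃ ψ : ∀ x, (η.Fiber x ⊗[ℂ] η.Fiber x) ≃ₗ[ℂ] ℂ, ∀ (x₀ : X) (a b : ℂ),
    ContMDiffAt 𝓘(ℂ, Fin n → ℂ) 𝓘(ℂ, ℂ) ω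
      (fun x => ψ x ((trivializationAt ℂ η.Fiber x₀).symmL ℂ x a ⊗ₜ[ℂ]
        (trivializationAt ℂ η.Fiber x₀).symmL ℂ x b)) x₀

variable [IsManifold 𝓘(ℂ, Fin n → ℂ) ω X]

/-- A global holomorphic section of `Sⁿ Ω¹_X (-K_X) ⊗ η`.

The fibre of `K_X` at `x` is the line of alternating `n`-linear forms on `T_x X`, the fibre of
`Sⁿ Ω¹_X ⊗ η` at `x` is the space of symmetric `n`-linear maps `(T_x X)ⁿ → η_x`, and tensoring
with `-K_X` is taking linear maps out of `K_X`; thus the section assigns to `μ ∈ K_{X,x}` a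
symmetric map `toFun x μ`. -/
structure TwistedSymmetricTensor (η : HolomorphicLineBundle n X) where
  /-- The value at a point. -/
  toFun : ∀ x : X, ((TangentSpace 𝓘(ℂ, Fin n → ℂ) x) [⋀^Fin n]→ₗ[ℂ] ℂ) →ₗ[ℂ]
    MultilinearMap ℂ (fun _ : Fin n => TangentSpace 𝓘(ℂ, Fin n → ℂ) x) (η.Fiber x)
  symmetric : ∀ x μ (v : Fin n → TangentSpace 𝓘(ℂ, Fin n → ℂ) x) (σ : Equiv.Perm (Fin n)),
    toFun x μ (v ∘ σ) = toFun x μ v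
  /-- Holomorphy: in local holomorphic coordinates around `x₀`, evaluating on an `n`-form `μ` and
  on vector fields `v i` with constant coefficients gives a holomorphic local section of `η`. -/
  holomorphic : ∀ (x₀ : X) (μ : (Fin n → ℂ) [⋀^Fin n]→ₗ[ℂ] ℂ) (v : Fin n → (Fin n → ℂ)),
    ContMDiffAt 𝓘(ℂ, Fin n → ℂ) (𝓘(ℂ, Fin n → ℂ).prod 𝓘(ℂ, ℂ)) ω
      (fun x => Bundle.TotalSpace.mk' ℂ x (toFun x
        (μ.compLinearMap ((trivializationAt (Fin n → ℂ)
          (TangentSpace 𝓘(ℂ, Fin n → ℂ) : X → Type _) x₀).continuousLinearMapAt ℂ x).toLinearMap)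
        (fun i => (trivializationAt (Fin n → ℂ)
          (TangentSpace 𝓘(ℂ, Fin n → ℂ) : X → Type _) x₀).symmL ℂ x (v i)))) x₀

variable (n X) in
/-- A semispecial tensor on `X`: a nonzero section of `Sⁿ Ω¹_X (-K_X) ⊗ η`, where `η` is a
holomorphic line bundle with `η ⊗ η ≅ 𝒪_X`. -/
structure SemispecialTensor where
  /-- The twisting line bundle. -/
  η : HolomorphicLineBundle n X
  /-- The section. -/
  tensor : TwistedSymmetricTensor η
  twoTorsion : η.IsTwoTorsion
  ne_zero : ∃ x, tensor.toFun x ≠ 0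

end Bundles

/-! ### Universal covers and powers of curves -/

/-- `p : Y → X` is a universal cover of the complex manifold `X` (with the complex structure on `Y`
for which `p` is locally biholomorphic). -/
structure IsHolomorphicUniversalCover (n : ℕ) {X Y : Type*}
    [TopologicalSpace X] [ChartedSpace (Fin n → ℂ) X]
    [TopologicalSpace Y] [ChartedSpace (Fin n → ℂ) Y] (p : Y → X) : Prop where
  simplyConnected : SimplyConnectedSpace Y
  isCoveringMap : IsCoveringMap p
  surjective : Function.Surjective p
  isLocalDiffeomorph : IsLocalDiffeomorph 𝓘(ℂ, Fin n → ℂ) 𝓘(ℂ, Fin n → ℂ) ω p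

/-- The model of the complex manifold `Cⁿ`, where `C` is a complex curve. -/
noncomputable abbrev powerModel (n : ℕ) :
    ModelWithCorners ℂ (Fin n → ℂ) (ModelPi fun _ : Fin n => ℂ) :=
  ModelWithCorners.pi fun _ : Fin n => 𝓘(ℂ, ℂ)

/-- `Cⁿ` is a complex manifold. -/
instance (n : ℕ) (C : Type*) [TopologicalSpace C] [ChartedSpace ℂ C] [IsManifold 𝓘(ℂ, ℂ) ω C] :
    IsManifold (powerModel n) ω (Fin n → C) := by
  refine isManifold_of_contDiffOn _ _ _ ?_
  rintro e e' ⟨f, hf, rfl⟩ ⟨f', hf', rfl⟩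
  rw [contDiffOn_pi]
  intro i
  have h := contDiffGroupoid ω 𝓘(ℂ, ℂ) |>.compatible (hf i (Set.mem_univ _))
    (hf' i (Set.mem_univ _))
  rw [contDiffGroupoid, mem_groupoid_of_pregroupoid, contDiffPregroupoid] at h
  have h1 : ContDiffOn ℂ ω ((f i).symm ≫ₕ f' i) ((f i).symm ≫ₕ f' i).source := by
    simpa [ContDiffOn, contDiffPregroupoid] using h.1
  refine h1.comp (contDiff_apply ℂ ℂ i).contDiffOn ?_
  rintro x ⟨⟨hx, hx'⟩, -⟩
  exact ⟨hx i (Set.mem_univ _), hx' i (Set.mem_univ _)⟩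

section Powers

variable {n : ℕ} {C : Type*} [TopologicalSpace C] [ChartedSpace ℂ C]

/-- The tensor `(dz₁ ⊗ ⋯ ⊗ dzₙ) / (dz₁ ∧ ⋯ ∧ dzₙ)` at a point `y` of `Cⁿ`, as a function of an
`n`-form `μ` and of `n` tangent vectors `v j` at `y`. Here `(z₁, …, zₙ)` is the product of the
preferred charts of `C` at the `y i`, by which the tangent space at `y` is identified with `ℂⁿ`,
so that `v j i = dzᵢ (v j)`. Thus `μ / (dz₁ ∧ ⋯ ∧ dzₙ)` is the value of `μ` on the standard basis,
and the class of `dz₁ ⊗ ⋯ ⊗ dzₙ` in the symmetric power is the symmetric `n`-linear form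
`v ↦ 1/n! ∑_τ ∏ᵢ dzᵢ (v (τ i))`. Changing the charts of the factors does not change the tensor;
for the half-plane, and on `ℂⁿ ⊆ (ℙ¹)ⁿ`, the `zᵢ` are the standard coordinates. -/
noncomputable def standardTensor (y : Fin n → C)
    (μ : (TangentSpace (powerModel n) y) [⋀^Fin n]→ₗ[ℂ] ℂ)
    (v : Fin n → TangentSpace (powerModel n) y) : ℂ :=
  μ (fun i => (Pi.single i 1 : Fin n → ℂ)) *
    ((n.factorial : ℂ)⁻¹ * ∑ τ : Equiv.Perm (Fin n), ∏ i, (v (τ i) : Fin n → ℂ) i)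

/-- The biholomorphism `g` of `Cⁿ` induces the permutation `σ` of the factors:
`g (y) i = h i (y (σ i))` for automorphisms `h i` of `C`. -/
def InducesPermutation (g : (Fin n → C) ≃ₘ^ω⟮powerModel n, powerModel n⟯ (Fin n → C))
    (σ : Equiv.Perm (Fin n)) : Prop :=
  ∃ h : Fin n → (C ≃ₘ^ω⟮𝓘(ℂ, ℂ), 𝓘(ℂ, ℂ)⟯ C), ∀ y i, g y i = h i (y (σ i))

variable {X : Type*} [TopologicalSpace X] [ChartedSpace (Fin n → ℂ) X]
  [IsManifold 𝓘(ℂ, Fin n → ℂ) ω X]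

/-- The semispecial tensor `T` on `X` is descended from `(dz₁ ⊗ ⋯ ⊗ dzₙ) / (dz₁ ∧ ⋯ ∧ dzₙ)` along
the covering `q : Cⁿ → X`, and its line bundle `η` is the one associated to the sign character:
the pull-back `q^* η` has a nowhere vanishing holomorphic section `e` such that
* `q^* T` is the standard tensor times `e`;
* every automorphism `g` of `Cⁿ` over `X` permutes the factors (up to automorphisms of `C`), by a
  permutation `σ`, and `e ∘ g = sign σ • e`. -/
def SemispecialTensor.IsDescendedFromStandard (T : SemispecialTensor n X)
    (q : (Fin n → C) → X) : Prop :=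
  ∃ e : ∀ y : Fin n → C, T.η.Fiber (q y),
    ContMDiff (powerModel n) (𝓘(ℂ, Fin n → ℂ).prod 𝓘(ℂ, ℂ)) ω
      (fun y => Bundle.TotalSpace.mk' ℂ (q y) (e y)) ∧
    (∀ y, e y ≠ 0) ∧
    (∀ (y : Fin n → C) (μ : (TangentSpace 𝓘(ℂ, Fin n → ℂ) (q y)) [⋀^Fin n]→ₗ[ℂ] ℂ)
      (v : Fin n → TangentSpace (powerModel n) y),
      T.tensor.toFun (q y) μ
          (fun i => mfderiv (powerModel n) 𝓘(ℂ, Fin n → ℂ) q y (v i)) =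
        standardTensor y (μ.compLinearMap
          (mfderiv (powerModel n) 𝓘(ℂ, Fin n → ℂ) q y).toLinearMap) v • e y) ∧
    (∀ g : (Fin n → C) ≃ₘ^ω⟮powerModel n, powerModel n⟯ (Fin n → C), (∀ y, q (g y) = q y) →
      ∃ σ : Equiv.Perm (Fin n), InducesPermutation g σ ∧ ∀ y : Fin n → C,
        Bundle.TotalSpace.mk' ℂ (q (g y)) (e (g y)) =
          Bundle.TotalSpace.mk' ℂ (q y) (((Equiv.Perm.sign σ : ℤ) : ℂ) • e y))

end Powers

/-! ### Calculus on powers of a curve -/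

section PowerCalculus

variable {n : ℕ} {C : Type*} [TopologicalSpace C] [ChartedSpace ℂ C]

/-! Write `q = p ∘ Φ`. The proof rests on one fact about `Cⁿ`: every automorphism permutes the
factors up to automorphisms of `C`. Its differential is then monomial, `(D w) i = c i * w (σ i)`, so
`dz₁ ⊗ ⋯ ⊗ dzₙ` is multiplied by `∏ c i` and `dz₁ ∧ ⋯ ∧ dzₙ` by `sign σ * ∏ c i`. The quotient
changes only by `sign σ` (`standardForm_monomial`). Hence the standard tensor descends along `q`
once it is twisted by the flat line bundle whose transition functions are the signs of the deck
transformations relating local sections of `q`; signs square to one, so this bundle is two-torsion.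

For the fact about automorphisms it suffices that each row of the Jacobian has a single nonzero
entry at every point (`exists_inducesPermutation`): by connectedness its column does not move, so
each component depends on one coordinate only.

For `ℍ`, Schwarz–Pick makes the Jacobians of `g` and `g⁻¹`, normalised by imaginary parts, matrices
with absolute row sums at most one; being mutually inverse, they have a single nonzero entry in each
row. For `ℙ¹`, the products `∂gᵢ/∂yⱼ · ∂(g⁻¹)ⱼ/∂w_l` with `i ≠ l` are values of holomorphic
one-forms on `ℙ¹`, and there are none but zero. -/

theorem extChartAt_power_source (y : Fin n → C) :
    (extChartAt (powerModel n) y).source =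
      Set.univ.pi fun i => (extChartAt 𝓘(ℂ, ℂ) (y i)).source := by
  simp [OpenPartialHomeomorph.pi]

theorem extChartAt_power_target (y : Fin n → C) :
    (extChartAt (powerModel n) y).target =
      Set.univ.pi fun i => (extChartAt 𝓘(ℂ, ℂ) (y i)).target := by
  ext w
  simp only [OpenPartialHomeomorph.pi, ModelWithCorners.pi, mfld_simps]
  rfl

theorem range_powerModel : Set.range (powerModel n) = Set.univ := by
  simp [powerModel, ModelWithCorners.pi]

theorem hasMFDerivAt_power_eval (y : Fin n → C) (i : Fin n) :
    HasMFDerivAt (powerModel n) 𝓘(ℂ, ℂ) (fun z : Fin n → C => z i) y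
      (ContinuousLinearMap.proj (R := ℂ) (φ := fun _ : Fin n => ℂ) i) := by
  refine ⟨(continuous_apply i).continuousAt, ?_⟩
  have h := (ContinuousLinearMap.proj (R := ℂ) (φ := fun _ : Fin n => ℂ) i).hasFDerivWithinAt
    (s := Set.range (powerModel n)) (x := extChartAt (powerModel n) y y)
  refine h.congr_of_eventuallyEq ?_ ?_
  · filter_upwards [extChartAt_target_mem_nhdsWithin (I := powerModel n) y] with w hw
    rw [extChartAt_power_target] at hw
    exact (extChartAt 𝓘(ℂ, ℂ) (y i)).right_inv (hw i trivial)
  · exact (extChartAt 𝓘(ℂ, ℂ) (y i)).right_inv (mem_extChartAt_target _)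

theorem contMDiff_power_eval {m : ℕ∞ω} [IsManifold 𝓘(ℂ, ℂ) ω C] (i : Fin n) :
    ContMDiff (powerModel n) 𝓘(ℂ, ℂ) m (fun z : Fin n → C => z i) := by
  intro y
  refine contMDiffAt_iff.2 ⟨(continuous_apply i).continuousAt, ?_⟩
  have h := (ContinuousLinearMap.proj (R := ℂ) (φ := fun _ : Fin n => ℂ) i).contDiff.contDiffWithinAt
    (n := m) (s := Set.range (powerModel n)) (x := extChartAt (powerModel n) y y)
  refine h.congr_of_eventuallyEq ?_ ?_
  · filter_upwards [extChartAt_target_mem_nhdsWithin (I := powerModel n) y] with w hw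
    rw [extChartAt_power_target] at hw
    exact (extChartAt 𝓘(ℂ, ℂ) (y i)).right_inv (hw i trivial)
  · exact (extChartAt 𝓘(ℂ, ℂ) (y i)).right_inv (mem_extChartAt_target _)

variable {E H M : Type*} [NormedAddCommGroup E] [NormedSpace ℂ E] [TopologicalSpace H]
  {J : ModelWithCorners ℂ E H} [TopologicalSpace M] [ChartedSpace H M]

/-- The preferred charts of `Fin n → C` are products, so the components of the coordinate expression
of `f` are by definition the coordinate expressions of the components. -/
theorem contMDiffAt_power {m : ℕ∞ω} {f : M → Fin n → C} {x : M}
    (hf : ∀ i, ContMDiffAt J 𝓘(ℂ, ℂ) m (fun z => f z i) x) :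
    ContMDiffAt J (powerModel n) m f x := by
  refine contMDiffAt_iff.2 ⟨continuousAt_pi.2 fun i => (hf i).continuousAt, ?_⟩
  rw [contDiffWithinAt_pi]
  intro i
  exact (contMDiffAt_iff.1 (hf i)).2

theorem contMDiff_power {m : ℕ∞ω} {f : M → Fin n → C}
    (hf : ∀ i, ContMDiff J 𝓘(ℂ, ℂ) m (fun z => f z i)) :
    ContMDiff J (powerModel n) m f := fun x => contMDiffAt_power fun i => hf i x

theorem mdifferentiableAt_power {f : M → Fin n → C} {x : M}
    (hf : ∀ i, MDifferentiableAt J 𝓘(ℂ, ℂ) (fun z => f z i) x) :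
    MDifferentiableAt J (powerModel n) f x := by
  refine (mdifferentiableAt_iff _ _).2 ⟨continuousAt_pi.2 fun i => (hf i).continuousAt, ?_⟩
  rw [differentiableWithinAt_pi]
  intro i
  exact ((mdifferentiableAt_iff _ _).1 (hf i)).2

theorem mfderiv_power_apply {f : M → Fin n → C} {x : M}
    (hf : MDifferentiableAt J (powerModel n) f x) (v : TangentSpace J x) (i : Fin n) :
    (mfderiv J (powerModel n) f x v : Fin n → ℂ) i =
      mfderiv J 𝓘(ℂ, ℂ) (fun z => f z i) x v := by
  have h := (hasMFDerivAt_power_eval (f x) i).comp x hf.hasMFDerivAt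
  exact (congrArg (fun L : TangentSpace J x →L[ℂ] ℂ => L v) h.mfderiv).symm

theorem contMDiff_update [IsManifold 𝓘(ℂ, ℂ) ω C] {m : ℕ∞ω} (y : Fin n → C) (j : Fin n) :
    ContMDiff 𝓘(ℂ, ℂ) (powerModel n) m (fun ζ : C => Function.update y j ζ) := by
  refine contMDiff_power fun i => ?_
  by_cases h : i = j
  · subst h
    simp only [Function.update_self]
    exact contMDiff_id
  · simpa [Function.update_of_ne h] using contMDiff_const

theorem mfderiv_update [IsManifold 𝓘(ℂ, ℂ) ω C] (y : Fin n → C) (j : Fin n) (ζ : C)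
    (a : ℂ) :
    (mfderiv 𝓘(ℂ, ℂ) (powerModel n) (fun ζ : C => Function.update y j ζ) ζ a : Fin n → ℂ) =
      Pi.single j a := by
  funext i
  have := mfderiv_power_apply
    (((contMDiff_update (m := ω) y j) ζ).mdifferentiableAt (by simp)) a i
  refine this.trans ?_
  by_cases h : i = j
  · subst h
    have h := (hasMFDerivAt_id (I := 𝓘(ℂ, ℂ)) ζ).congr_of_eventuallyEq
      (f₁ := fun z => Function.update y i z i) (.of_forall fun z => by simp)
    rw [Pi.single_eq_same]
    exact congrArg (fun L : ℂ →L[ℂ] ℂ => L a) h.mfderiv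
  · have h := (hasMFDerivAt_const (I := 𝓘(ℂ, ℂ)) (I' := 𝓘(ℂ, ℂ)) (y i) ζ).congr_of_eventuallyEq
      (f₁ := fun z => Function.update y j z i) (.of_forall fun z => by simp [h])
    rw [Pi.single_eq_of_ne ‹_›]
    exact congrArg (fun L : ℂ →L[ℂ] ℂ => L a) h.mfderiv

end PowerCalculus

/-! ### Coordinate changes on the tangent bundle of a power are diagonal -/

section TangentCoordinates

variable {n : ℕ} {C : Type*} [TopologicalSpace C] [ChartedSpace ℂ C] [IsManifold 𝓘(ℂ, ℂ) ω C]

theorem tangentCoordChange_power {x y z : Fin n → C}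
    (h : z ∈ (extChartAt (powerModel n) x).source ∩ (extChartAt (powerModel n) y).source)
    (v : Fin n → ℂ) (i : Fin n) :
    tangentCoordChange (powerModel n) x y z v i =
      tangentCoordChange 𝓘(ℂ, ℂ) (x i) (y i) (z i) (v i) := by
  have h1 := hasFDerivWithinAt_tangentCoordChange (I := powerModel n) h
  rw [range_powerModel, hasFDerivWithinAt_univ, hasFDerivAt_pi'] at h1
  have hi : z i ∈ (extChartAt 𝓘(ℂ, ℂ) (x i)).source ∩ (extChartAt 𝓘(ℂ, ℂ) (y i)).source := by
    rw [extChartAt_power_source, extChartAt_power_source] at h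
    exact ⟨h.1 i trivial, h.2 i trivial⟩
  have h2 := hasFDerivWithinAt_tangentCoordChange (I := 𝓘(ℂ, ℂ)) hi
  rw [modelWithCornersSelf_coe, Set.range_id, hasFDerivWithinAt_univ] at h2
  have h3 := h2.comp (f := fun w : Fin n → ℂ => w i) (extChartAt (powerModel n) x z)
    (hasFDerivAt_apply i _)
  exact congrArg (fun L : (Fin n → ℂ) →L[ℂ] ℂ => L v) ((h1 i).unique h3)

theorem tangentCoordChange_curve_apply (x y z : C) (a : ℂ) :
    tangentCoordChange 𝓘(ℂ, ℂ) x y z a = tangentCoordChange 𝓘(ℂ, ℂ) x y z 1 * a := by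
  conv_lhs => rw [← mul_one a, ← smul_eq_mul, map_smul, smul_eq_mul, mul_comm]

/-- Changing coordinates from `x` to `y` and back is the identity. -/
theorem tangentCoordChange_curve_ne_zero {x y z : C}
    (h : z ∈ (extChartAt 𝓘(ℂ, ℂ) x).source ∩ (extChartAt 𝓘(ℂ, ℂ) y).source) :
    tangentCoordChange 𝓘(ℂ, ℂ) x y z 1 ≠ 0 := by
  intro h0
  have h1 := tangentCoordChange_comp (I := 𝓘(ℂ, ℂ)) (v := (1 : ℂ)) (w := x) (x := y) (y := x)
    ⟨⟨h.1, h.2⟩, h.1⟩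
  rw [h0, map_zero, tangentCoordChange_self h.1] at h1
  exact one_ne_zero h1.symm

end TangentCoordinates

/-! ### Linear algebra of the standard tensor -/

section StandardForm

variable {n : ℕ}

/-- The tensor `(dz₁ ⊗ ⋯ ⊗ dzₙ) / (dz₁ ∧ ⋯ ∧ dzₙ)` on the vector space `ℂⁿ`. -/
noncomputable def standardForm (μ : (Fin n → ℂ) [⋀^Fin n]→ₗ[ℂ] ℂ) (v : Fin n → Fin n → ℂ) : ℂ :=
  μ (fun i => Pi.single i 1) *
    ((n.factorial : ℂ)⁻¹ * ∑ τ : Equiv.Perm (Fin n), ∏ i, v (τ i) i)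

/-- A monomial matrix has permanent `∏ c i` and determinant `sign σ * ∏ c i`; the two factors `∏ c
i` sit on opposite sides and match without division, so `D` need not be invertible. -/
theorem standardForm_monomial (μ : (Fin n → ℂ) [⋀^Fin n]→ₗ[ℂ] ℂ) (v : Fin n → Fin n → ℂ)
    (D : (Fin n → ℂ) →ₗ[ℂ] (Fin n → ℂ)) (σ : Equiv.Perm (Fin n)) (c : Fin n → ℂ)
    (hD : ∀ w i, D w i = c i * w (σ i)) :
    standardForm μ (fun i => D (v i)) =
      ((Equiv.Perm.sign σ : ℤ) : ℂ) * standardForm (μ.compLinearMap D) v := by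
  have h1 : ∀ k, D (Pi.single k 1) = c (σ⁻¹ k) • (Pi.single (σ⁻¹ k) 1 : Fin n → ℂ) := by
    intro k
    funext i
    rw [hD]
    by_cases h : i = σ⁻¹ k
    · subst h; simp
    · have : σ i ≠ k := fun e => h (by simp [← e])
      rw [Pi.single_eq_of_ne this, Pi.smul_apply, Pi.single_eq_of_ne h]
      simp
  have h2 : μ.compLinearMap D (fun i => Pi.single i 1) =
      (∏ i, c i) * (((Equiv.Perm.sign σ : ℤ) : ℂ) * μ (fun i => Pi.single i 1)) := by
    rw [AlternatingMap.compLinearMap_apply]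
    simp only [h1]
    have h3 := μ.map_smul_univ (fun k => c (σ⁻¹ k))
      (fun k => (Pi.single (σ⁻¹ k) 1 : Fin n → ℂ))
    refine h3.trans ?_
    rw [Equiv.prod_comp (σ⁻¹) c, smul_eq_mul]
    congr 1
    have h4 := μ.map_perm (fun k => (Pi.single k 1 : Fin n → ℂ)) (σ⁻¹)
    refine Eq.trans h4 ?_
    simp [Units.smul_def]
  have h5 : ∑ τ : Equiv.Perm (Fin n), ∏ i, D (v (τ i)) i =
      (∏ i, c i) * ∑ τ : Equiv.Perm (Fin n), ∏ i, v (τ i) i := by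
    -- Replacing `τ` by `τ * σ` turns the factors into `v (τ (σ i)) (σ i)`, and the product over `i`
    -- absorbs `σ`.
    rw [Finset.mul_sum, ← Equiv.sum_comp (Equiv.mulRight σ)]
    refine Finset.sum_congr rfl fun τ _ => ?_
    simp only [hD, Finset.prod_mul_distrib]
    congr 1
    exact Equiv.prod_comp σ fun i => v (τ i) i
  have h6 : (((Equiv.Perm.sign σ : ℤ) : ℂ)) * ((Equiv.Perm.sign σ : ℤ) : ℂ) = 1 := by
    rw [← Int.cast_mul, Int.units_coe_mul_self, Int.cast_one]
  unfold standardForm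
  rw [h2, h5]
  linear_combination (-(μ (fun i => Pi.single i 1)) * (∏ i, c i) *
    ((n.factorial : ℂ)⁻¹ * ∑ τ : Equiv.Perm (Fin n), ∏ i, v (τ i) i)) * h6

/-- The Leibniz formula, spelled out so that the pull-back of a form is visibly polynomial in the
entries of the linear map. -/
theorem alternatingMap_eq_sum (μ : (Fin n → ℂ) [⋀^Fin n]→ₗ[ℂ] ℂ) (w : Fin n → Fin n → ℂ) :
    μ w = μ (fun i => Pi.single i 1) *
      ∑ τ : Equiv.Perm (Fin n), ((Equiv.Perm.sign τ : ℤ) : ℂ) * ∏ i, w (τ i) i := by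
  have h := μ.eq_smul_basis_det (Pi.basisFun ℂ (Fin n))
  conv_lhs => rw [h]
  simp only [AlternatingMap.smul_apply, smul_eq_mul, Module.Basis.det_apply, Matrix.det_apply']
  congr 1
  · congr 1
    funext i
    simp
  · rw [← Matrix.det_apply', ← Matrix.det_transpose, Matrix.det_apply']
    simp [Module.Basis.toMatrix]

theorem standardForm_perm (μ : (Fin n → ℂ) [⋀^Fin n]→ₗ[ℂ] ℂ) (v : Fin n → Fin n → ℂ)
    (σ : Equiv.Perm (Fin n)) : standardForm μ (v ∘ σ) = standardForm μ v := by
  unfold standardForm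
  congr 2
  exact (Equiv.sum_comp (Equiv.mulLeft σ) fun τ : Equiv.Perm (Fin n) => ∏ i, v (τ i) i)

/-- The permanent as a multilinear map. -/
noncomputable def permanentMap (n : ℕ) : MultilinearMap ℂ (fun _ : Fin n => (Fin n → ℂ)) ℂ :=
  ∑ τ : Equiv.Perm (Fin n), (MultilinearMap.mkPiAlgebra ℂ (Fin n) ℂ).compLinearMap
    fun k => LinearMap.proj (τ.symm k)

theorem permanentMap_apply (v : Fin n → Fin n → ℂ) :
    permanentMap n v = ∑ τ : Equiv.Perm (Fin n), ∏ i, v (τ i) i := by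
  simp only [permanentMap, sum_apply, MultilinearMap.compLinearMap_apply,
    MultilinearMap.mkPiAlgebra_apply, LinearMap.proj_apply]
  refine Finset.sum_congr rfl fun τ _ => ?_
  rw [← Equiv.prod_comp τ]
  simp

/-- `standardForm` as a linear map from top forms to multilinear maps. -/
noncomputable def standardFormHom (n : ℕ) : ((Fin n → ℂ) [⋀^Fin n]→ₗ[ℂ] ℂ) →ₗ[ℂ]
    MultilinearMap ℂ (fun _ : Fin n => (Fin n → ℂ)) ℂ where
  toFun μ := (μ (fun i => Pi.single i 1) * (n.factorial : ℂ)⁻¹) • permanentMap n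
  map_add' μ ν := by rw [← add_smul, ← add_mul]; rfl
  map_smul' a μ := by rw [smul_smul, RingHom.id_apply, ← mul_assoc]; rfl

theorem standardFormHom_apply (μ : (Fin n → ℂ) [⋀^Fin n]→ₗ[ℂ] ℂ) (v : Fin n → Fin n → ℂ) :
    standardFormHom n μ v = standardForm μ v := by
  change (_ * _) * permanentMap n v = _
  rw [permanentMap_apply, mul_assoc]
  rfl

theorem exists_standardForm_ne_zero (n : ℕ) : ∃ (μ : (Fin n → ℂ) [⋀^Fin n]→ₗ[ℂ] ℂ)
    (v : Fin n → Fin n → ℂ), standardForm μ v ≠ 0 := by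
  refine ⟨Matrix.detRowAlternating, fun i => Pi.single i 1, ?_⟩
  have h : ∑ τ : Equiv.Perm (Fin n), ∏ i, (Pi.single (τ i) 1 : Fin n → ℂ) i = 1 := by
    rw [Finset.sum_eq_single 1]
    · simp
    · intro τ _ hτ
      obtain ⟨i, hi⟩ : ∃ i, τ i ≠ i := by
        by_contra! h
        exact hτ (Equiv.ext h)
      exact Finset.prod_eq_zero (Finset.mem_univ i) (Pi.single_eq_of_ne (Ne.symm hi) _)
    · simp
  have h' : Matrix.detRowAlternating (fun i => (Pi.single i 1 : Fin n → ℂ)) = (1 : ℂ) := by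
    have : (fun i => (Pi.single i 1 : Fin n → ℂ)) = (1 : Matrix (Fin n) (Fin n) ℂ) := by
      ext i j
      simp [Matrix.one_apply, Pi.single_apply, eq_comm]
    rw [this]
    exact Matrix.det_one
  unfold standardForm
  rw [h, h']
  simp [Nat.factorial_ne_zero]

variable {E H M : Type*} [NormedAddCommGroup E] [NormedSpace ℂ E] [TopologicalSpace H]
  {J : ModelWithCorners ℂ E H} [TopologicalSpace M] [ChartedSpace H M]

/-- The expression is polynomial in the entries of `A z` and `B z`. Two families are allowed because
the application takes the differentials of `q` and of a local section, which avoids inverting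
matrices. -/
theorem contMDiffAt_standardForm {m : ℕ∞ω} {A B : M → (Fin n → ℂ) →L[ℂ] (Fin n → ℂ)} {x : M}
    (hA : ContMDiffAt J 𝓘(ℂ, (Fin n → ℂ) →L[ℂ] (Fin n → ℂ)) m A x)
    (hB : ContMDiffAt J 𝓘(ℂ, (Fin n → ℂ) →L[ℂ] (Fin n → ℂ)) m B x)
    (μ : (Fin n → ℂ) [⋀^Fin n]→ₗ[ℂ] ℂ) (v : Fin n → Fin n → ℂ) :
    ContMDiffAt J 𝓘(ℂ, ℂ) m
      (fun z => standardForm (μ.compLinearMap (A z).toLinearMap) (fun i => B z (v i))) x := by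
  have key : ∀ {L : M → (Fin n → ℂ) →L[ℂ] (Fin n → ℂ)},
      ContMDiffAt J 𝓘(ℂ, (Fin n → ℂ) →L[ℂ] (Fin n → ℂ)) m L x →
      ∀ (w : Fin n → ℂ) (i : Fin n), ContMDiffAt J 𝓘(ℂ, ℂ) m (fun z => L z w i) x := by
    intro L hL w i
    have h1 : ContDiff ℂ m (fun T : (Fin n → ℂ) →L[ℂ] (Fin n → ℂ) => T w i) :=
      ((ContinuousLinearMap.proj (R := ℂ) (φ := fun _ : Fin n => ℂ) i).comp
        (ContinuousLinearMap.apply ℂ (Fin n → ℂ) w)).contDiff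
    exact h1.contMDiff.contMDiffAt.comp x hL
  unfold standardForm
  have h1 : ∀ z, (μ.compLinearMap (A z).toLinearMap) (fun i => Pi.single i 1) =
      μ (fun i => Pi.single i 1) * ∑ τ : Equiv.Perm (Fin n), ((Equiv.Perm.sign τ : ℤ) : ℂ) *
        ∏ i, A z (Pi.single (τ i) 1) i := fun z => by
    rw [AlternatingMap.compLinearMap_apply, alternatingMap_eq_sum]
    rfl
  simp only [h1]
  refine ContMDiffAt.mul ?_ ?_
  · refine contMDiffAt_const.mul (contMDiffAt_finsetSum fun τ _ => contMDiffAt_const.mul ?_)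
    exact contMDiffAt_finsetProd fun i _ => key hA _ i
  · refine contMDiffAt_const.mul (contMDiffAt_finsetSum fun τ _ => ?_)
    exact contMDiffAt_finsetProd fun i _ => key hB _ i

end StandardForm

/-! ### Deck transformations -/

section Deck

variable {E H M : Type*} [NormedAddCommGroup E] [NormedSpace ℂ E] [TopologicalSpace H]
  {J : ModelWithCorners ℂ E H} [TopologicalSpace M] [ChartedSpace H M]
  {E' H' X : Type*} [NormedAddCommGroup E'] [NormedSpace ℂ E'] [TopologicalSpace H']
  {I : ModelWithCorners ℂ E' H'} [TopologicalSpace X] [ChartedSpace H' X]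
  {q : M → X}

/-- Near each point, `F` is `q` followed by a local inverse of `q`. -/
theorem IsLocalDiffeomorph.contMDiff_of_lift (hq : IsLocalDiffeomorph J I ω q) {F : M → M}
    (hF : Continuous F) (h : ∀ z, q (F z) = q z) : ContMDiff J J ω F := by
  intro z
  have hz := hq (F z)
  have h1 : F =ᶠ[𝓝 z] fun w => hz.localInverse (q w) := by
    have : ∀ᶠ w in 𝓝 z, F w ∈ hz.localInverse.target :=
      hF.continuousAt.eventually_mem
        (hz.localInverse.open_target.mem_nhds hz.localInverse_mem_target)
    filter_upwards [this] with w hw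
    rw [← h w, hz.localInverse_left_inv hw]
  have h2 : ContMDiffAt I J ω hz.localInverse (q z) := by
    rw [← h z]; exact hz.localInverse_contMDiffAt
  exact (h2.comp z (hq.contMDiff z)).congr_of_eventuallyEq h1

/-- The deck transformations of a simply connected covering act transitively on the fibres. -/
theorem exists_deck_diffeomorph [SimplyConnectedSpace M] [LocallyPathConnectedSpace M]
    (hq : IsLocalDiffeomorph J I ω q) (hcov : IsCoveringMap q) {y y' : M} (h : q y = q y') :
    ∃ g : M ≃ₘ^ω⟮J, J⟯ M, (∀ z, q (g z) = q z) ∧ g y = y' := by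
  let Q : C(M, X) := ⟨q, hcov.continuous⟩
  obtain ⟨F, ⟨hF1, hF2⟩, -⟩ := hcov.existsUnique_continuousMap_lifts Q y y' h.symm
  obtain ⟨G, ⟨hG1, hG2⟩, -⟩ := hcov.existsUnique_continuousMap_lifts Q y' y h
  have hF3 : ∀ z, q (F z) = q z := fun z => congrFun hF2 z
  have hG3 : ∀ z, q (G z) = q z := fun z => congrFun hG2 z
  -- Both compositions are lifts of `q` with a fixed point, hence the identity by uniqueness of
  -- lifts.
  have hGF : G ∘ F = id := hcov.eq_of_comp_eq (G.continuous.comp F.continuous) continuous_id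
    (funext fun z => by simp [hF3, hG3]) y (by simp [hF1, hG1])
  have hFG : F ∘ G = id := hcov.eq_of_comp_eq (F.continuous.comp G.continuous) continuous_id
    (funext fun z => by simp [hF3, hG3]) y' (by simp [hF1, hG1])
  exact ⟨{ toFun := F, invFun := G, left_inv := congrFun hGF, right_inv := congrFun hFG
           contMDiff_toFun := hq.contMDiff_of_lift F.continuous hF3
           contMDiff_invFun := hq.contMDiff_of_lift G.continuous hG3 }, hF3, hF1⟩

end Deck

/-! ### The sign cocycle of the deck transformations -/

section PermutationSign

variable {n : ℕ} {C : Type*} [TopologicalSpace C] [ChartedSpace ℂ C]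

/-- Since `h i` is injective, changing the coordinate `σ i` alone changes the `i`-th component of
`g`. This would be impossible if that component were a function of another coordinate `τ i`. -/
theorem InducesPermutation.unique [Nontrivial C]
    {g : (Fin n → C) ≃ₘ^ω⟮powerModel n, powerModel n⟯ (Fin n → C)} {σ τ : Equiv.Perm (Fin n)}
    (hσ : InducesPermutation g σ) (hτ : InducesPermutation g τ) : σ = τ := by
  obtain ⟨h, hh⟩ := hσ
  obtain ⟨k, hk⟩ := hτ
  obtain ⟨a, b, hab⟩ := exists_pair_ne C
  refine Equiv.ext fun i => ?_
  by_contra hne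
  have h1 := hh (fun _ => a) i
  have h2 := hh (Function.update (fun _ => a) (σ i) b) i
  rw [hk] at h1 h2
  rw [Function.update_of_ne (Ne.symm hne), h1, Function.update_self] at h2
  exact hab ((h i).injective h2)

/-- The order is reversed: component `i` of `g'` reads coordinate `τ i` of `g y`, which reads
coordinate `σ (τ i)` of `y`. -/
theorem InducesPermutation.trans
    {g g' : (Fin n → C) ≃ₘ^ω⟮powerModel n, powerModel n⟯ (Fin n → C)} {σ τ : Equiv.Perm (Fin n)}
    (hσ : InducesPermutation g σ) (hτ : InducesPermutation g' τ) :
    InducesPermutation (g.trans g') (σ * τ) := by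
  obtain ⟨h, hh⟩ := hσ
  obtain ⟨k, hk⟩ := hτ
  exact ⟨fun i => (h (τ i)).trans (k i), fun y i => by
    simp [hh, hk]⟩

theorem inducesPermutation_refl :
    InducesPermutation (Diffeomorph.refl (powerModel n) (Fin n → C) ω) 1 :=
  ⟨fun _ => Diffeomorph.refl _ _ _, fun _ _ => rfl⟩

variable {X : Type*} [TopologicalSpace X] [ChartedSpace (Fin n → ℂ) X]

open Classical in
/-- The sign of the permutation of the factors induced by the deck transformation of `q` that
sends `y` to `y'`. -/
noncomputable def deckSign (q : (Fin n → C) → X) (y y' : Fin n → C) : ℤˣ :=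
  -- The value `1` is a default; over a permuting cover the condition holds for any two points of
  -- one fibre, by `exists_deck`.
  if h : ∃ (σ : Equiv.Perm (Fin n)) (g : (Fin n → C) ≃ₘ^ω⟮powerModel n, powerModel n⟯ (Fin n → C)),
      (∀ z, q (g z) = q z) ∧ g y = y' ∧ InducesPermutation g σ then Equiv.Perm.sign h.choose else 1

/-- `q` is a covering of `X` by a simply connected power of a curve `C`, all of whose
automorphisms permute the factors. -/
structure IsPermutingCover (q : (Fin n → C) → X) : Prop where
  simplyConnected : SimplyConnectedSpace (Fin n → C)
  nontrivial : Nontrivial C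
  surjective : Function.Surjective q
  isCoveringMap : IsCoveringMap q
  isLocalDiffeomorph : IsLocalDiffeomorph (powerModel n) 𝓘(ℂ, Fin n → ℂ) ω q
  permutes : ∀ g : (Fin n → C) ≃ₘ^ω⟮powerModel n, powerModel n⟯ (Fin n → C),
    ∃ σ, InducesPermutation g σ

namespace IsPermutingCover

variable {q : (Fin n → C) → X} (hq : IsPermutingCover q)

include hq

theorem exists_deck {y y' : Fin n → C} (h : q y = q y') :
    ∃ (g : (Fin n → C) ≃ₘ^ω⟮powerModel n, powerModel n⟯ (Fin n → C)) (σ : Equiv.Perm (Fin n)),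
      (∀ z, q (g z) = q z) ∧ g y = y' ∧ InducesPermutation g σ := by
  have := hq.simplyConnected
  have : LocallyPathConnectedSpace (ModelPi fun _ : Fin n => ℂ) :=
    inferInstanceAs (LocallyPathConnectedSpace (Fin n → ℂ))
  have : LocallyPathConnectedSpace (Fin n → C) :=
    ChartedSpace.locallyPathConnectedSpace (ModelPi fun _ : Fin n => ℂ) (Fin n → C)
  obtain ⟨g, hg, hgy⟩ := exists_deck_diffeomorph hq.isLocalDiffeomorph hq.isCoveringMap h
  obtain ⟨σ, hσ⟩ := hq.permutes g
  exact ⟨g, σ, hg, hgy, hσ⟩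

/-- The choice inside `deckSign` is harmless: deck transformations that agree at `y` coincide, and a
transformation determines its permutation. -/
theorem deckSign_eq {g : (Fin n → C) ≃ₘ^ω⟮powerModel n, powerModel n⟯ (Fin n → C)}
    {σ : Equiv.Perm (Fin n)} (hg : ∀ z, q (g z) = q z) (hσ : InducesPermutation g σ)
    (y : Fin n → C) : deckSign q y (g y) = Equiv.Perm.sign σ := by
  have hex : ∃ (τ : Equiv.Perm (Fin n))
      (k : (Fin n → C) ≃ₘ^ω⟮powerModel n, powerModel n⟯ (Fin n → C)),
      (∀ z, q (k z) = q z) ∧ k y = g y ∧ InducesPermutation k τ := ⟨σ, g, hg, rfl, hσ⟩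
  rw [deckSign, dif_pos hex]
  obtain ⟨k, hk, hky, hτ⟩ := hex.choose_spec
  have := hq.simplyConnected
  have := hq.nontrivial
  have hkg : (k : (Fin n → C) → (Fin n → C)) = g :=
    hq.isCoveringMap.eq_of_comp_eq k.contMDiff_toFun.continuous g.contMDiff_toFun.continuous
      (funext fun z => by simp [hk, hg]) y hky
  have hkg' : k = g := Diffeomorph.ext (congrFun hkg)
  rw [hkg'] at hτ
  rw [hτ.unique hσ]

theorem deckSign_self (y : Fin n → C) : deckSign q y y = 1 := by
  simpa using hq.deckSign_eq (g := Diffeomorph.refl _ _ _) (fun _ => rfl) inducesPermutation_refl y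

theorem deckSign_mul {y y' y'' : Fin n → C} (h : q y = q y') (h' : q y' = q y'') :
    deckSign q y y' * deckSign q y' y'' = deckSign q y y'' := by
  obtain ⟨g, σ, hg, rfl, hσ⟩ := hq.exists_deck h
  obtain ⟨g', σ', hg', rfl, hσ'⟩ := hq.exists_deck h'
  rw [hq.deckSign_eq hg hσ, hq.deckSign_eq hg' hσ', ← Equiv.Perm.sign_mul]
  exact (hq.deckSign_eq (g := g.trans g') (fun z => (hg' (g z)).trans (hg z))
    (hσ.trans hσ') y).symm

theorem deckSign_comm {y y' : Fin n → C} (h : q y = q y') : deckSign q y y' = deckSign q y' y := by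
  have h1 := hq.deckSign_mul h h.symm
  rw [hq.deckSign_self] at h1
  rw [← Int.units_inv_eq_self (deckSign q y' y)]
  exact eq_inv_of_mul_eq_one_left h1

/-- The deck transformation taking `s x` to `s' x` also takes `s z` to `s' z` for `z` near `x`,
because `q` is injective near `s' x`. -/
theorem eventually_deckSign_eq {W : Type*} [TopologicalSpace W] {s s' : W → Fin n → C} {x : W}
    (hs : ContinuousAt s x) (hs' : ContinuousAt s' x) (h : ∀ᶠ z in 𝓝 x, q (s z) = q (s' z)) :
    ∀ᶠ z in 𝓝 x, deckSign q (s z) (s' z) = deckSign q (s x) (s' x) := by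
  obtain ⟨g, σ, hg, hgy, hσ⟩ := hq.exists_deck h.self_of_nhds
  rw [← hgy, hq.deckSign_eq hg hσ]
  have hl := hq.isLocalDiffeomorph (s' x)
  have hU : hl.localInverse.target ∈ 𝓝 (s' x) :=
    hl.localInverse.open_target.mem_nhds hl.localInverse_mem_target
  have h1 : ContinuousAt (fun z => g (s z)) x :=
    (g.contMDiff_toFun.continuous.continuousAt).comp hs
  have h2 : ∀ᶠ z in 𝓝 x, g (s z) ∈ hl.localInverse.target :=
    h1.eventually_mem (by rw [hgy]; exact hU)
  filter_upwards [h, h2, hs'.eventually_mem hU] with z hz hz2 hz3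
  have h4 : g (s z) = s' z := by
    rw [← hl.localInverse_left_inv hz2, ← hl.localInverse_left_inv hz3, hg, hz]
  rw [← h4, hq.deckSign_eq hg hσ]

end IsPermutingCover

end PermutationSign

/-! ### The line bundle of the sign character -/

section SignBundle

variable {n : ℕ} {C : Type*} [TopologicalSpace C] [ChartedSpace ℂ C]
  {X : Type*} [TopologicalSpace X] [ChartedSpace (Fin n → ℂ) X]

namespace IsPermutingCover

variable {q : (Fin n → C) → X} (hq : IsPermutingCover q)

/-- The local section of `q` through `y`. -/
noncomputable def sectionAt (y : Fin n → C) : PartialDiffeomorph 𝓘(ℂ, Fin n → ℂ) (powerModel n)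
    X (Fin n → C) ω := (hq.isLocalDiffeomorph y).localInverse

theorem mem_sectionAt_source (y : Fin n → C) : q y ∈ (hq.sectionAt y).source :=
  (hq.isLocalDiffeomorph y).localInverse_mem_source

theorem sectionAt_apply_self (y : Fin n → C) : hq.sectionAt y (q y) = y :=
  (hq.isLocalDiffeomorph y).localInverse_left_inv (hq.isLocalDiffeomorph y).localInverse_mem_target

theorem map_sectionAt {y : Fin n → C} {x : X} (hx : x ∈ (hq.sectionAt y).source) :
    q (hq.sectionAt y x) = x :=
  (hq.isLocalDiffeomorph y).localInverse_right_inv hx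

theorem contMDiffAt_sectionAt {y : Fin n → C} {x : X} (hx : x ∈ (hq.sectionAt y).source) :
    ContMDiffAt 𝓘(ℂ, Fin n → ℂ) (powerModel n) ω (hq.sectionAt y) x :=
  (hq.sectionAt y).contMDiffOn.contMDiffAt ((hq.sectionAt y).open_source.mem_nhds hx)

/-- A point of the fibre of `q` over `x`. -/
noncomputable def basePoint (x : X) : Fin n → C := Function.surjInv hq.surjective x

theorem map_basePoint (x : X) : q (hq.basePoint x) = x := Function.surjInv_eq hq.surjective x

theorem mem_sectionAt_basePoint (x : X) : x ∈ (hq.sectionAt (hq.basePoint x)).source := by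
  simpa [hq.map_basePoint x] using hq.mem_sectionAt_source (hq.basePoint x)

theorem sectionAt_basePoint (x : X) : hq.sectionAt (hq.basePoint x) x = hq.basePoint x := by
  simpa [hq.map_basePoint x] using hq.sectionAt_apply_self (hq.basePoint x)

theorem eventually_deckSign_sectionAt {i j : Fin n → C} {x : X}
    (hi : x ∈ (hq.sectionAt i).source) (hj : x ∈ (hq.sectionAt j).source) :
    ∀ᶠ z in 𝓝 x, deckSign q (hq.sectionAt i z) (hq.sectionAt j z) =
      deckSign q (hq.sectionAt i x) (hq.sectionAt j x) := by
  refine hq.eventually_deckSign_eq (hq.contMDiffAt_sectionAt hi).continuousAt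
    (hq.contMDiffAt_sectionAt hj).continuousAt ?_
  filter_upwards [(hq.sectionAt i).open_source.mem_nhds hi,
    (hq.sectionAt j).open_source.mem_nhds hj] with z hz hz'
  rw [hq.map_sectionAt hz, hq.map_sectionAt hz']

/-- The transition functions of the line bundle associated to the sign character. -/
noncomputable def signCore : VectorBundleCore ℂ X ℂ (Fin n → C) where
  baseSet i := (hq.sectionAt i).source
  isOpen_baseSet i := (hq.sectionAt i).open_source
  -- `basePoint` is an arbitrary, possibly discontinuous choice; it only names the preferred
  -- trivialisation at each point.
  indexAt := hq.basePoint
  mem_baseSet_at := hq.mem_sectionAt_basePoint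
  coordChange i j x := ((deckSign q (hq.sectionAt i x) (hq.sectionAt j x) : ℤ) : ℂ) •
    ContinuousLinearMap.id ℂ ℂ
  coordChange_self i x hx v := by simp [hq.deckSign_self]
  continuousOn_coordChange i j := by
    rintro x ⟨hi, hj⟩
    refine ContinuousAt.continuousWithinAt (continuousAt_const.congr
      (f := fun _ => ((deckSign q (hq.sectionAt i x) (hq.sectionAt j x) : ℤ) : ℂ) •
        ContinuousLinearMap.id ℂ ℂ) ?_)
    filter_upwards [hq.eventually_deckSign_sectionAt hi hj] with z hz
    rw [hz]
  coordChange_comp i j k x hx v := by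
    obtain ⟨⟨hi, hj⟩, hk⟩ := hx
    have h := hq.deckSign_mul ((hq.map_sectionAt hi).trans (hq.map_sectionAt hj).symm)
      ((hq.map_sectionAt hj).trans (hq.map_sectionAt hk).symm)
    simp only [smul_apply, ContinuousLinearMap.id_apply, smul_eq_mul]
    rw [← h]
    push_cast
    ring

instance : (hq.signCore).IsContMDiff 𝓘(ℂ, Fin n → ℂ) ω where
  contMDiffOn_coordChange i j := by
    rintro x ⟨hi, hj⟩
    refine ContMDiffAt.contMDiffWithinAt ?_
    refine (contMDiffAt_const (c := ((deckSign q (hq.sectionAt i x) (hq.sectionAt j x) : ℤ) : ℂ) •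
        ContinuousLinearMap.id ℂ ℂ)).congr_of_eventuallyEq ?_
    filter_upwards [hq.eventually_deckSign_sectionAt hi hj] with z hz
    simp only [signCore]
    rw [hz]

/-- The line bundle on `X` associated to the sign character. -/
noncomputable def signBundle : HolomorphicLineBundle n X where
  Fiber := hq.signCore.Fiber

/-- The coordinate on the fibre of the sign bundle given by its preferred trivialisation. -/
noncomputable def toFiber (x : X) : ℂ ≃ₗ[ℂ] hq.signBundle.Fiber x := LinearEquiv.refl ℂ ℂ

theorem trivializationAt_toFiber (x₀ x : X) (c : ℂ) :
    (trivializationAt ℂ hq.signBundle.Fiber x₀ (Bundle.TotalSpace.mk' ℂ x (hq.toFiber x c))).2 =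
      ((deckSign q (hq.basePoint x) (hq.sectionAt (hq.basePoint x₀) x) : ℤ) : ℂ) * c := by
  conv_rhs => rw [← hq.sectionAt_basePoint x]
  rfl

theorem trivializationAt_symmL {x₀ x : X} (hx : x ∈ (hq.sectionAt (hq.basePoint x₀)).source)
    (c : ℂ) : (trivializationAt ℂ hq.signBundle.Fiber x₀).symmL ℂ x c =
      hq.toFiber x
        (((deckSign q (hq.sectionAt (hq.basePoint x₀) x) (hq.basePoint x) : ℤ) : ℂ) * c) := by
  conv_rhs => rw [← hq.sectionAt_basePoint x]
  exact congrArg (fun L : ℂ →L[ℂ] ℂ => L c) (hq.signCore.trivializationAt_symmL hx)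

theorem intCast_units_mul_self (u : ℤˣ) : ((u : ℤ) : ℂ) * ((u : ℤ) : ℂ) = 1 := by
  rw [← Int.cast_mul, Int.units_coe_mul_self, Int.cast_one]

/-- Transition functions are `±1`, so the product of two fibre coordinates is the same in every
trivialisation; on a local frame the pairing is the constant `a * b`. -/
theorem signBundle_isTwoTorsion : hq.signBundle.IsTwoTorsion := by
  refine ⟨fun x => (TensorProduct.congr (hq.toFiber x).symm (hq.toFiber x).symm).trans
    (TensorProduct.lid ℂ ℂ), fun x₀ a b => ?_⟩
  refine (contMDiffAt_const (c := a * b)).congr_of_eventuallyEq ?_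
  filter_upwards [(hq.sectionAt (hq.basePoint x₀)).open_source.mem_nhds
    (hq.mem_sectionAt_basePoint x₀)] with x hx
  rw [hq.trivializationAt_symmL hx, hq.trivializationAt_symmL hx, LinearEquiv.trans_apply,
    TensorProduct.congr_tmul, LinearEquiv.symm_apply_apply, LinearEquiv.symm_apply_apply,
    TensorProduct.lid_tmul, smul_eq_mul]
  linear_combination (a * b) * intCast_units_mul_self
    (deckSign q (hq.sectionAt (hq.basePoint x₀) x) (hq.basePoint x))

end IsPermutingCover
end SignBundle

/-! ### Pointwise descent of the tensor -/

section Descent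

variable {n : ℕ} {C : Type*} [TopologicalSpace C] [ChartedSpace ℂ C]
  {X : Type*} [TopologicalSpace X] [ChartedSpace (Fin n → ℂ) X]

/-- The tensor `(dz₁ ⊗ ⋯ ⊗ dzₙ) / (dz₁ ∧ ⋯ ∧ dzₙ)` transported by a linear automorphism. -/
noncomputable def pushforwardForm (L : (Fin n → ℂ) ≃L[ℂ] (Fin n → ℂ)) :
    ((Fin n → ℂ) [⋀^Fin n]→ₗ[ℂ] ℂ) →ₗ[ℂ] MultilinearMap ℂ (fun _ : Fin n => (Fin n → ℂ)) ℂ :=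
  (MultilinearMap.compLinearMapₗ fun _ => L.symm.toLinearMap) ∘ₗ
    standardFormHom n ∘ₗ
      { toFun := fun μ => μ.compLinearMap L.toLinearMap
        map_add' := fun _ _ => rfl
        map_smul' := fun _ _ => rfl }

theorem pushforwardForm_apply (L : (Fin n → ℂ) ≃L[ℂ] (Fin n → ℂ))
    (μ : (Fin n → ℂ) [⋀^Fin n]→ₗ[ℂ] ℂ) (v : Fin n → Fin n → ℂ) :
    pushforwardForm L μ v =
      standardForm (μ.compLinearMap L.toLinearMap) (fun i => L.symm (v i)) :=
  standardFormHom_apply _ _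

theorem mfderiv_apply_of_inducesPermutation [IsManifold 𝓘(ℂ, ℂ) ω C]
    {g : (Fin n → C) ≃ₘ^ω⟮powerModel n, powerModel n⟯ (Fin n → C)} {σ : Equiv.Perm (Fin n)}
    (hσ : InducesPermutation g σ) (y : Fin n → C) : ∃ c : Fin n → ℂ, ∀ (w : Fin n → ℂ) i,
      (mfderiv (powerModel n) (powerModel n) g y w : Fin n → ℂ) i = c i * w (σ i) := by
  obtain ⟨h, hh⟩ := hσ
  let c : Fin n → ℂ →L[ℂ] ℂ := fun i => mfderiv 𝓘(ℂ, ℂ) 𝓘(ℂ, ℂ) (h i) (y (σ i))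
  refine ⟨fun i => c i 1, fun w i => ?_⟩
  refine (mfderiv_power_apply (g.contMDiff_toFun y |>.mdifferentiableAt (by simp)) w i).trans ?_
  have h1 : HasMFDerivAt 𝓘(ℂ, ℂ) 𝓘(ℂ, ℂ) (h i) (y (σ i)) _ :=
    ((h i).contMDiff_toFun _ |>.mdifferentiableAt (by simp)).hasMFDerivAt
  have h2 := (h1.comp y (hasMFDerivAt_power_eval y (σ i))).congr_of_eventuallyEq
    (f₁ := fun z => g z i) (.of_forall fun z => hh z i)
  refine (congrArg (fun L : (Fin n → ℂ) →L[ℂ] ℂ => L w) h2.mfderiv).trans ?_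
  change c i (w (σ i)) = c i 1 * w (σ i)
  conv_lhs => rw [← mul_one (w (σ i)), ← smul_eq_mul, map_smul, smul_eq_mul, mul_comm]

namespace IsPermutingCover

variable {q : (Fin n → C) → X} (hq : IsPermutingCover q)

/-- The differential of `q` as a linear automorphism of `ℂⁿ`. -/
noncomputable def differential (y : Fin n → C) : (Fin n → ℂ) ≃L[ℂ] (Fin n → ℂ) :=
  (hq.isLocalDiffeomorph y).mfderivToContinuousLinearEquiv (by simp)

/-- Differentiating `q ∘ g = q` shows that the differentials of `q` at `y` and `y' = g y` differ by
the monomial map `Dg`, to which `standardForm_monomial` applies. -/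
theorem pushforwardForm_differential [IsManifold 𝓘(ℂ, ℂ) ω C] {y y' : Fin n → C} (h : q y = q y')
    (μ : (Fin n → ℂ) [⋀^Fin n]→ₗ[ℂ] ℂ) (v : Fin n → Fin n → ℂ) :
    pushforwardForm (hq.differential y') μ v =
      ((deckSign q y y' : ℤ) : ℂ) * pushforwardForm (hq.differential y) μ v := by
  obtain ⟨g, σ, hg, rfl, hσ⟩ := hq.exists_deck h
  rw [hq.deckSign_eq hg hσ]
  obtain ⟨c, hc⟩ := mfderiv_apply_of_inducesPermutation hσ y
  let D : (Fin n → ℂ) →L[ℂ] (Fin n → ℂ) := mfderiv (powerModel n) (powerModel n) g y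
  have hD : ∀ w, hq.differential (g y) (D w) = hq.differential y w := by
    intro w
    have h1 : HasMFDerivAt (powerModel n) (powerModel n) g y D :=
      (g.contMDiff_toFun y |>.mdifferentiableAt (by simp)).hasMFDerivAt
    have h2 := (hq.isLocalDiffeomorph.mdifferentiable (by simp) (g y)).hasMFDerivAt
    have h3 := (h2.comp y h1).congr_of_eventuallyEq
      (f₁ := q) (.of_forall fun z => (hg z).symm)
    exact (congrArg (fun L : (Fin n → ℂ) →L[ℂ] (Fin n → ℂ) => L w) h3.mfderiv).symm
  rw [pushforwardForm_apply, pushforwardForm_apply]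
  have h4 := standardForm_monomial (μ.compLinearMap (hq.differential (g y)).toLinearMap)
    (fun i => (hq.differential y).symm (v i)) D.toLinearMap σ c hc
  have h5 : (fun i => D.toLinearMap ((hq.differential y).symm (v i))) =
      fun i => (hq.differential (g y)).symm (v i) := by
    funext i
    rw [ContinuousLinearEquiv.eq_symm_apply]
    exact (hD _).trans (ContinuousLinearEquiv.apply_symm_apply _ _)
  have h6 : (μ.compLinearMap (hq.differential (g y)).toLinearMap).compLinearMap D.toLinearMap =
      μ.compLinearMap (hq.differential y).toLinearMap := by
    ext w
    exact congrArg μ (funext fun i => hD (w i))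
  rw [h5, h6] at h4
  exact h4

/-- The value of the descended tensor at a point. -/
noncomputable def tensorValue (x : X) :
    ((TangentSpace 𝓘(ℂ, Fin n → ℂ) x) [⋀^Fin n]→ₗ[ℂ] ℂ) →ₗ[ℂ]
    MultilinearMap ℂ (fun _ : Fin n => TangentSpace 𝓘(ℂ, Fin n → ℂ) x) (hq.signBundle.Fiber x) :=
  (LinearMap.compMultilinearMapₗ ℂ (hq.toFiber x).toLinearMap) ∘ₗ
    pushforwardForm (hq.differential (hq.basePoint x))

theorem tensorValue_apply (x : X) (μ : (TangentSpace 𝓘(ℂ, Fin n → ℂ) x) [⋀^Fin n]→ₗ[ℂ] ℂ)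
    (v : Fin n → TangentSpace 𝓘(ℂ, Fin n → ℂ) x) :
    hq.tensorValue x μ v =
      hq.toFiber x (pushforwardForm (hq.differential (hq.basePoint x)) μ v) := rfl

end IsPermutingCover
end Descent

/-! ### Holomorphy of the descended tensor and its pull-back -/

section Descended

variable {n : ℕ} {C : Type*} [TopologicalSpace C] [ChartedSpace ℂ C] [IsManifold 𝓘(ℂ, ℂ) ω C]
  {X : Type*} [TopologicalSpace X] [ChartedSpace (Fin n → ℂ) X]
  [IsManifold 𝓘(ℂ, Fin n → ℂ) ω X]

/-- Moving between the frames of the preferred charts at `y` and at `z` is diagonal, a monomial map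
with trivial permutation, so it leaves the standard tensor unchanged. -/
theorem symmL_trivializationAt_power {y z : Fin n → C}
    (h : z ∈ (extChartAt (powerModel n) y).source) : ∃ c : Fin n → ℂ, ∀ (w : Fin n → ℂ) i,
    ((trivializationAt (Fin n → ℂ) (TangentSpace (powerModel n) : (Fin n → C) → Type _) y).symmL
      ℂ z w : Fin n → ℂ) i = c i * w i := by
  refine ⟨fun i => tangentCoordChange 𝓘(ℂ, ℂ) (y i) (z i) (z i) 1, fun w i => ?_⟩
  rw [TangentBundle.symmL_trivializationAt_eq_core (by rwa [extChartAt_source] at h)]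
  rw [← tangentCoordChange_curve_apply]
  exact tangentCoordChange_power ⟨h, mem_extChartAt_source z⟩ w i

namespace IsPermutingCover

variable {q : (Fin n → C) → X} (hq : IsPermutingCover q)

/-- `hq.differential` is written in preferred charts, which may jump with the point, so it need not
be continuous. Inserting the diagonal change to the fixed frame at `y` does not affect the standard
form and leaves the differentials of `q` and of its local section in fixed frames, which are
holomorphic. -/
theorem contMDiffAt_pushforwardForm (y : Fin n → C) (μ : (Fin n → ℂ) [⋀^Fin n]→ₗ[ℂ] ℂ)
    (v : Fin n → (Fin n → ℂ)) :
    ContMDiffAt 𝓘(ℂ, Fin n → ℂ) 𝓘(ℂ, ℂ) ω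
      (fun x => pushforwardForm (hq.differential (hq.sectionAt y x))
        (μ.compLinearMap ((trivializationAt (Fin n → ℂ)
          (TangentSpace 𝓘(ℂ, Fin n → ℂ) : X → Type _) (q y)).continuousLinearMapAt ℂ x).toLinearMap)
        (fun i => (trivializationAt (Fin n → ℂ)
          (TangentSpace 𝓘(ℂ, Fin n → ℂ) : X → Type _) (q y)).symmL ℂ x (v i))) (q y) := by
  set s := hq.sectionAt y with hs
  have hsy : s (q y) = y := hq.sectionAt_apply_self y
  have hss : ContMDiffAt 𝓘(ℂ, Fin n → ℂ) (powerModel n) ω s (q y) :=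
    hq.contMDiffAt_sectionAt (hq.mem_sectionAt_source y)
  let TX := trivializationAt (Fin n → ℂ) (TangentSpace 𝓘(ℂ, Fin n → ℂ) : X → Type _) (q y)
  let TY := trivializationAt (Fin n → ℂ) (TangentSpace (powerModel n) : (Fin n → C) → Type _) y
  let a : X → (Fin n → ℂ) →L[ℂ] (Fin n → ℂ) := fun x => TX.continuousLinearMapAt ℂ x
  let b : X → (Fin n → ℂ) →L[ℂ] (Fin n → ℂ) := fun x => TX.symmL ℂ x
  let d : X → (Fin n → ℂ) →L[ℂ] (Fin n → ℂ) := fun x => TY.symmL ℂ (s x)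
  let d' : X → (Fin n → ℂ) →L[ℂ] (Fin n → ℂ) := fun x => TY.continuousLinearMapAt ℂ (s x)
  let ds : X → (Fin n → ℂ) →L[ℂ] (Fin n → ℂ) := fun x =>
    mfderiv 𝓘(ℂ, Fin n → ℂ) (powerModel n) s x
  let dq : X → (Fin n → ℂ) →L[ℂ] (Fin n → ℂ) := fun x =>
    mfderiv (powerModel n) 𝓘(ℂ, Fin n → ℂ) q (s x)
  have hA : ContMDiffAt 𝓘(ℂ, Fin n → ℂ) 𝓘(ℂ, (Fin n → ℂ) →L[ℂ] (Fin n → ℂ)) ω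
      (fun x => (a (q (s x))).comp ((dq x).comp (d x))) (q y) :=
    ContMDiffAt.comp_of_eq (ContMDiffAt.mfderiv_const (m := ω)
      (hq.isLocalDiffeomorph.contMDiff y) le_rfl) hss hsy
  have hB : ContMDiffAt 𝓘(ℂ, Fin n → ℂ) 𝓘(ℂ, (Fin n → ℂ) →L[ℂ] (Fin n → ℂ)) ω
      (fun x => (d' x).comp ((ds x).comp (b x))) (q y) := by
    have h := ContMDiffAt.mfderiv_const (m := ω) hss le_rfl
    unfold inTangentCoordinates at h
    rw [hsy] at h
    exact h
  refine (contMDiffAt_standardForm hA hB μ v).congr_of_eventuallyEq ?_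
  have hsrc : ∀ᶠ x in 𝓝 (q y), s x ∈ (extChartAt (powerModel n) y).source :=
    hss.continuousAt.eventually_mem (by rw [hsy]; exact extChartAt_source_mem_nhds y)
  filter_upwards [s.open_source.mem_nhds (hq.mem_sectionAt_source y), hsrc] with x hx hx'
  have hqs : q (s x) = x := hq.map_sectionAt hx
  obtain ⟨c, hc⟩ := symmL_trivializationAt_power hx'
  have hdd' : ∀ w, d x (d' x w) = w := fun w =>
    TY.symmL_continuousLinearMapAt (by
      rw [TangentBundle.trivializationAt_baseSet]; rwa [extChartAt_source] at hx') w
  have hdqs : ∀ w, dq x (ds x w) = w := by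
    intro w
    have h1 := (hq.contMDiffAt_sectionAt hx).mdifferentiableAt (by simp) |>.hasMFDerivAt
    have h2 := (hq.isLocalDiffeomorph.mdifferentiable (by simp) (s x)).hasMFDerivAt
    have h3 := (h2.comp x h1).congr_of_eventuallyEq (f₁ := id) (by
      filter_upwards [s.open_source.mem_nhds hx] with z hz
      exact (hq.map_sectionAt hz).symm)
    exact congrArg (fun L : (Fin n → ℂ) →L[ℂ] (Fin n → ℂ) => L w)
      (h3.mfderiv.symm.trans mfderiv_id)
  refine (pushforwardForm_apply (hq.differential (s x)) (μ.compLinearMap (a x).toLinearMap)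
    (fun i => b x (v i))).trans ?_
  have h4 := standardForm_monomial
    ((μ.compLinearMap (a x).toLinearMap).compLinearMap (hq.differential (s x)).toLinearMap)
    (fun i => d' x (ds x (b x (v i)))) (d x).toLinearMap 1 c hc
  rw [Equiv.Perm.sign_one, Units.val_one, Int.cast_one, one_mul] at h4
  have h5 : (fun i => (d x).toLinearMap (d' x (ds x (b x (v i))))) =
      fun i => (hq.differential (s x)).symm (b x (v i)) := by
    funext i
    rw [ContinuousLinearEquiv.eq_symm_apply]
    refine (congrArg (hq.differential (s x)) (hdd' _)).trans (hdqs _)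
  rw [h5] at h4
  refine h4.trans ?_
  rw [hqs]
  rfl

omit [IsManifold 𝓘(ℂ, ℂ) ω C] [IsManifold 𝓘(ℂ, Fin n → ℂ) ω X] in
theorem contMDiffAt_toFiber {E H M : Type*} [NormedAddCommGroup E] [NormedSpace ℂ E]
    [TopologicalSpace H] {J : ModelWithCorners ℂ E H} [TopologicalSpace M] [ChartedSpace H M]
    {f : M → X} {c : M → ℂ} {w : M} (hf : ContMDiffAt J 𝓘(ℂ, Fin n → ℂ) ω f w)
    (hc : ContMDiffAt J 𝓘(ℂ, ℂ) ω (fun z => ((deckSign q (hq.basePoint (f z))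
      (hq.sectionAt (hq.basePoint (f w)) (f z)) : ℤ) : ℂ) * c z) w) :
    ContMDiffAt J (𝓘(ℂ, Fin n → ℂ).prod 𝓘(ℂ, ℂ)) ω
      (fun z => Bundle.TotalSpace.mk' ℂ (f z) (hq.toFiber (f z) (c z))) w :=
  Bundle.contMDiffAt_totalSpace.2 ⟨hf, hc.congr_of_eventuallyEq
    (.of_forall fun z => hq.trivializationAt_toFiber (f w) (f z) (c z))⟩

/-- The tensor on `X` descended from `(dz₁ ⊗ ⋯ ⊗ dzₙ) / (dz₁ ∧ ⋯ ∧ dzₙ)`. -/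
noncomputable def descendedTensor : TwistedSymmetricTensor hq.signBundle where
  toFun := hq.tensorValue
  symmetric x μ v σ := by
    rw [tensorValue_apply, tensorValue_apply]
    congr 1
    have h1 := pushforwardForm_apply (hq.differential (hq.basePoint x)) μ (v ∘ σ)
    have h2 := pushforwardForm_apply (hq.differential (hq.basePoint x)) μ v
    exact h1.trans ((standardForm_perm _
      (fun i => (hq.differential (hq.basePoint x)).symm (v i)) σ).trans h2.symm)
  holomorphic x₀ μ v := by
    have h := hq.contMDiffAt_pushforwardForm (hq.basePoint x₀) μ v
    rw [hq.map_basePoint] at h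
    refine hq.contMDiffAt_toFiber contMDiffAt_id (h.congr_of_eventuallyEq ?_)
    filter_upwards [(hq.sectionAt (hq.basePoint x₀)).open_source.mem_nhds
      (hq.mem_sectionAt_basePoint x₀)] with x hx
    -- The sign of the trivialisation cancels the jump from `basePoint x` to the local section
    -- through `basePoint x₀`.
    exact (hq.pushforwardForm_differential
      ((hq.map_basePoint x).trans (hq.map_sectionAt hx).symm) _ _).symm

theorem descendedTensor_ne_zero (x : X) : hq.descendedTensor.toFun x ≠ 0 := by
  intro h0
  obtain ⟨μ, v, hv⟩ := exists_standardForm_ne_zero n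
  let L := hq.differential (hq.basePoint x)
  have h1 : ∀ μ' v', pushforwardForm L μ' v' = 0 := fun μ' v' =>
    (LinearEquiv.map_eq_zero_iff (hq.toFiber x)).1
      ((hq.tensorValue_apply x μ' v').symm.trans
        (by rw [show hq.tensorValue x = 0 from h0]; rfl))
  -- Transporting `μ` and `v` by `L` undoes the push-forward.
  have h2 := (pushforwardForm_apply L (μ.compLinearMap L.symm.toLinearMap)
    (fun i => L (v i))).symm.trans (h1 _ _)
  refine hv ?_
  convert h2 using 2
  · ext w
    simp
  · funext i
    simp

/-- The semispecial tensor descended from `(dz₁ ⊗ ⋯ ⊗ dzₙ) / (dz₁ ∧ ⋯ ∧ dzₙ)`. -/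
noncomputable def semispecialTensor [Nonempty X] : SemispecialTensor n X where
  η := hq.signBundle
  tensor := hq.descendedTensor
  twoTorsion := hq.signBundle_isTwoTorsion
  ne_zero := ⟨Classical.arbitrary X, hq.descendedTensor_ne_zero _⟩

theorem isDescendedFromStandard [Nonempty X] :
    hq.semispecialTensor.IsDescendedFromStandard q := by
  -- `e y` is the frame attached to the point `y` of the fibre, in the coordinate attached to
  -- `basePoint (q y)`: the sign compares the two points.
  refine ⟨fun y => hq.toFiber (q y) ((deckSign q (hq.basePoint (q y)) y : ℤ) : ℂ), ?_, ?_, ?_, ?_⟩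
  · intro y
    refine hq.contMDiffAt_toFiber (hq.isLocalDiffeomorph.contMDiff y) ?_
    let s := hq.sectionAt (hq.basePoint (q y))
    have hsq : ContinuousAt (fun z => s (q z)) y :=
      ContinuousAt.comp (hq.contMDiffAt_sectionAt (hq.mem_sectionAt_basePoint (q y))).continuousAt
        (hq.isLocalDiffeomorph.contMDiff y).continuousAt
    have hev : ∀ᶠ z in 𝓝 y, q z ∈ s.source :=
      (hq.isLocalDiffeomorph.contMDiff y).continuousAt.eventually_mem
        (s.open_source.mem_nhds (hq.mem_sectionAt_basePoint (q y)))
    have hloc := hq.eventually_deckSign_eq hsq (continuousAt_id (x := y))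
      (hev.mono fun z hz => hq.map_sectionAt hz)
    refine (contMDiffAt_const (c := ((deckSign q (s (q y)) y : ℤ) : ℂ))).congr_of_eventuallyEq ?_
    filter_upwards [hev, hloc] with z hz hz'
    rw [← Int.cast_mul, ← Units.val_mul]
    have hbs := (hq.map_basePoint (q z)).trans (hq.map_sectionAt hz).symm
    -- By the cocycle rule the base point drops out, leaving the locally constant sign from `s (q
    -- z)` to `z`.
    rw [hq.deckSign_comm hbs, hq.deckSign_mul hbs.symm (hq.map_basePoint (q z))]
    exact congrArg (fun u : ℤˣ => ((u : ℤ) : ℂ)) hz'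
  · intro y h0
    have h1 := (LinearEquiv.map_eq_zero_iff (hq.toFiber (q y))).1 h0
    simp at h1
  · intro y μ v
    have h1 := hq.pushforwardForm_differential (hq.map_basePoint (q y)) μ
      (fun i => hq.differential y (v i))
    have h2 := (pushforwardForm_apply (hq.differential y) μ
      (fun i => hq.differential y (v i))).trans (congrArg (standardForm _)
        (funext fun i => (hq.differential y).symm_apply_apply (v i)))
    have h3 : pushforwardForm (hq.differential (hq.basePoint (q y))) μ
        (fun i => hq.differential y (v i)) =
        standardTensor y (μ.compLinearMap
          (mfderiv (powerModel n) 𝓘(ℂ, Fin n → ℂ) q y).toLinearMap) v *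
        ((deckSign q (hq.basePoint (q y)) y : ℤ) : ℂ) := by
      refine Eq.trans ?_ (congrArg (· * ((deckSign q (hq.basePoint (q y)) y : ℤ) : ℂ)) h2)
      rw [h1]
      linear_combination (-pushforwardForm (hq.differential (hq.basePoint (q y))) μ
        (fun i => hq.differential y (v i))) *
        intCast_units_mul_self (deckSign q (hq.basePoint (q y)) y)
    refine (congrArg (hq.toFiber (q y)) h3).trans ?_
    exact (hq.toFiber (q y)).map_smul _ _
  · intro g hg
    obtain ⟨σ, hσ⟩ := hq.permutes g
    refine ⟨σ, hσ, fun y => ?_⟩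
    -- The fibres over `q (g y)` and `q y` are different types, so the point is generalised before
    -- substituting.
    have key : ∀ x, x = q y → Bundle.TotalSpace.mk' ℂ x
        (hq.toFiber x ((deckSign q (hq.basePoint x) (g y) : ℤ) : ℂ)) =
        Bundle.TotalSpace.mk' ℂ (q y) (((Equiv.Perm.sign σ : ℤ) : ℂ) •
          hq.toFiber (q y) ((deckSign q (hq.basePoint (q y)) y : ℤ) : ℂ)) := by
      rintro x rfl
      rw [← (hq.toFiber (q y)).map_smul, smul_eq_mul, ← Int.cast_mul, ← Units.val_mul,
        ← hq.deckSign_eq hg hσ y, mul_comm,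
        hq.deckSign_mul (hq.map_basePoint (q y)) (hg y).symm]
    exact key (q (g y)) (hg y)

end IsPermutingCover
end Descended

/-! ### Maps with vanishing differential -/

section LocallyConstant

variable {C : Type*} [TopologicalSpace C] [ChartedSpace ℂ C] [IsManifold 𝓘(ℂ, ℂ) ω C]

theorem eq_of_mfderiv_eq_zero [PreconnectedSpace C] {D : Type*} [TopologicalSpace D]
    [ChartedSpace ℂ D] [IsManifold 𝓘(ℂ, ℂ) ω D] {f : C → D}
    (hf : MDifferentiable 𝓘(ℂ, ℂ) 𝓘(ℂ, ℂ) f) (h0 : ∀ x, mfderiv 𝓘(ℂ, ℂ) 𝓘(ℂ, ℂ) f x = 0)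
    (a b : C) : f a = f b := by
  have : IsManifold 𝓘(ℂ, ℂ) 1 C := IsManifold.of_le (n := ω) (by simp)
  have : IsManifold 𝓘(ℂ, ℂ) 1 D := IsManifold.of_le (n := ω) (by simp)
  refine IsLocallyConstant.apply_eq_of_preconnectedSpace
    ((IsLocallyConstant.iff_eventually_eq f).2 fun x => ?_) a b
  set ψ := extChartAt 𝓘(ℂ, ℂ) x
  set φ := extChartAt 𝓘(ℂ, ℂ) (f x)
  have hψ : ContinuousAt ψ.symm (ψ x) := continuousAt_extChartAt_symm x
  have hx : ψ.symm (ψ x) = x := extChartAt_to_inv x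
  have h1 : ∀ᶠ w in 𝓝 (ψ x), w ∈ ψ.target ∧ f (ψ.symm w) ∈ φ.source := by
    refine Filter.Eventually.and (extChartAt_target_mem_nhds x) ?_
    refine ((hf.continuous.continuousAt).comp hψ).eventually_mem ?_
    simp only [Function.comp_apply, hx]
    exact extChartAt_source_mem_nhds _
  obtain ⟨r, hr, hball⟩ := Metric.eventually_nhds_iff_ball.1 h1
  have hd : ∀ w ∈ Metric.ball (ψ x) r, HasFDerivAt (fun w => φ (f (ψ.symm w))) (0 : ℂ →L[ℂ] ℂ) w := by
    intro w hw
    obtain ⟨hw1, hw2⟩ := hball w hw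
    have d1 : MDifferentiableAt 𝓘(ℂ, ℂ) 𝓘(ℂ, ℂ) ψ.symm w :=
      (contMDiffOn_extChartAt_symm (n := 1) x).mdifferentiableOn (by simp) w hw1
        |>.mdifferentiableAt (isOpen_extChartAt_target x |>.mem_nhds hw1)
    have d3 : MDifferentiableAt 𝓘(ℂ, ℂ) 𝓘(ℂ, ℂ) φ (f (ψ.symm w)) :=
      mdifferentiableAt_extChartAt (by rwa [extChartAt_source] at hw2)
    have d := d3.hasMFDerivAt.comp w ((hf (ψ.symm w)).hasMFDerivAt.comp w d1.hasMFDerivAt)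
    rw [h0] at d
    have d' := hasMFDerivAt_iff_hasFDerivAt.1 d
    have e : ∀ P Q : ℂ →L[ℂ] ℂ, P.comp ((0 : ℂ →L[ℂ] ℂ).comp Q) = 0 := fun P Q => by simp
    exact HasFDerivAt.congr_fderiv d' (e _ _)
  have hconst : ∀ w ∈ Metric.ball (ψ x) r, φ (f (ψ.symm w)) = φ (f (ψ.symm (ψ x))) := fun w hw =>
    (convex_ball (ψ x) r).is_const_of_fderivWithin_eq_zero (𝕜 := ℂ)
      (fun z hz => (hd z hz).differentiableAt.differentiableWithinAt)
      (fun z hz => by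
        rw [fderivWithin_of_isOpen Metric.isOpen_ball hz]
        exact (hd z hz).fderiv) hw (Metric.mem_ball_self hr)
  have hev : ∀ᶠ z in 𝓝 x, z ∈ ψ.source ∧ ψ z ∈ Metric.ball (ψ x) r :=
    Filter.Eventually.and (extChartAt_source_mem_nhds x)
      ((continuousAt_extChartAt x).eventually_mem (Metric.ball_mem_nhds _ hr))
  filter_upwards [hev] with z hz
  have h2 := hconst _ hz.2
  rw [hx, ψ.left_inv hz.1] at h2
  have h3 := (hball _ hz.2).2
  rw [ψ.left_inv hz.1] at h3
  exact φ.injOn h3 (mem_extChartAt_source (f x)) h2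

end LocallyConstant

/-! ### From monomial Jacobians to permutations of the factors -/

section Monomial

variable {n : ℕ} {C : Type*} [TopologicalSpace C] [ChartedSpace ℂ C] [IsManifold 𝓘(ℂ, ℂ) ω C]

/-- The Jacobian matrix of a self-map of `Cⁿ` in the preferred charts. -/
noncomputable def jacobian (g : (Fin n → C) → (Fin n → C)) (y : Fin n → C) (i j : Fin n) : ℂ :=
  (mfderiv (powerModel n) (powerModel n) g y (Pi.single j 1 : Fin n → ℂ) : Fin n → ℂ) i

omit [IsManifold 𝓘(ℂ, ℂ) ω C] in
theorem mfderiv_eq_sum_jacobian (g : (Fin n → C) → (Fin n → C)) (y : Fin n → C)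
    (w : Fin n → ℂ) (i : Fin n) :
    (mfderiv (powerModel n) (powerModel n) g y w : Fin n → ℂ) i =
      ∑ j, jacobian g y i j * w j := by
  let L : (Fin n → ℂ) →L[ℂ] (Fin n → ℂ) := mfderiv (powerModel n) (powerModel n) g y
  change L w i = ∑ j, L (Pi.single j 1) i * w j
  conv_lhs => rw [pi_eq_sum_univ' w, map_sum, Finset.sum_apply]
  refine Finset.sum_congr rfl fun j _ => ?_
  rw [map_smul, Pi.smul_apply, smul_eq_mul, mul_comm]

theorem jacobian_eq_mfderiv {g : (Fin n → C) → (Fin n → C)}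
    (hg : MDifferentiable (powerModel n) (powerModel n) g) (y : Fin n → C) (i j : Fin n) (ζ : C) :
    jacobian g (Function.update y j ζ) i j =
      mfderiv 𝓘(ℂ, ℂ) 𝓘(ℂ, ℂ) (fun ξ => g (Function.update y j ξ) i) ζ (1 : ℂ) := by
  have h1 := (((contMDiff_update (m := ω) y j) ζ).mdifferentiableAt (by simp)).hasMFDerivAt
  have h2 := (hasMFDerivAt_power_eval (g (Function.update y j ζ)) i).comp ζ
    ((hg (Function.update y j ζ)).hasMFDerivAt.comp ζ h1)
  refine Eq.trans ?_ (congrArg (fun L : ℂ →L[ℂ] ℂ => L 1) h2.mfderiv).symm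
  refine congrArg (fun w : Fin n → ℂ => (mfderiv (powerModel n) (powerModel n) g
    (Function.update y j ζ) w : Fin n → ℂ) i) (mfderiv_update y j ζ 1).symm

omit [IsManifold 𝓘(ℂ, ℂ) ω C] in
theorem sum_jacobian_mul_jacobian_symm
    (g : (Fin n → C) ≃ₘ^ω⟮powerModel n, powerModel n⟯ (Fin n → C)) (y : Fin n → C)
    (i k : Fin n) :
    ∑ j, jacobian g y i j * jacobian g.symm (g y) j k = if i = k then 1 else 0 := by
  have h1 : HasMFDerivAt (powerModel n) (powerModel n) g (g.symm (g y)) _ :=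
    (g.contMDiff_toFun _ |>.mdifferentiableAt (by simp)).hasMFDerivAt
  have h2 : HasMFDerivAt (powerModel n) (powerModel n) g.symm (g y) _ :=
    (g.symm.contMDiff_toFun _ |>.mdifferentiableAt (by simp)).hasMFDerivAt
  have h3 := (h1.comp (g y) h2).congr_of_eventuallyEq (f₁ := id)
    (.of_forall fun z => (g.apply_symm_apply z).symm)
  have h4 := congrArg (fun L : (Fin n → ℂ) →L[ℂ] (Fin n → ℂ) => L (Pi.single k 1) i)
    (h3.mfderiv.symm.trans mfderiv_id)
  have h5 := mfderiv_eq_sum_jacobian g (g.symm (g y))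
    (mfderiv (powerModel n) (powerModel n) g.symm (g y) (Pi.single k 1 : Fin n → ℂ)) i
  rw [g.symm_apply_apply] at h4 h5
  refine h5.symm.trans (h4.trans ?_)
  exact Pi.single_apply k (1 : ℂ) i

/-- The Jacobian entry itself may jump with the preferred charts, but it differs by a nonzero factor
from its expression in fixed frames near `y`, which is continuous. -/
theorem isOpen_jacobian_ne_zero {g : (Fin n → C) → (Fin n → C)}
    (hg : ContMDiff (powerModel n) (powerModel n) ω g) (i j : Fin n) :
    IsOpen {y | jacobian g y i j ≠ 0} := by
  rw [isOpen_iff_eventually]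
  intro y hy
  have h1 := (ContMDiffAt.mfderiv_const (m := ω) (hg y) le_rfl).continuousAt
  have h2 : ContinuousAt (fun z => inTangentCoordinates (powerModel n) (powerModel n) id g
      (fun z => mfderiv (powerModel n) (powerModel n) g z) y z (Pi.single j 1) i) y := by
    have := h1.clm_apply (continuousAt_const (y := (Pi.single j 1 : Fin n → ℂ)))
    exact (continuous_apply i).continuousAt.comp this
  have h3 : ∀ᶠ z in 𝓝 y, z ∈ (chartAt (ModelPi fun _ : Fin n => ℂ) y).source ∧
      g z ∈ (chartAt (ModelPi fun _ : Fin n => ℂ) (g y)).source :=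
    (eventually_mem_set.2 (chart_source_mem_nhds (ModelPi fun _ : Fin n => ℂ) y)).and
      ((hg y).continuousAt.eventually_mem (chart_source_mem_nhds _ (g y)))
  have h4 : ∀ z, z ∈ (chartAt (ModelPi fun _ : Fin n => ℂ) y).source ∧
      g z ∈ (chartAt (ModelPi fun _ : Fin n => ℂ) (g y)).source →
      ∃ c : ℂ, c ≠ 0 ∧ inTangentCoordinates (powerModel n) (powerModel n) id g
      (fun z => mfderiv (powerModel n) (powerModel n) g z) y z (Pi.single j 1) i =
        c * jacobian g z i j := by
    rintro z ⟨hz1, hz2⟩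
    have e1 : z ∈ (extChartAt (powerModel n) y).source ∩ (extChartAt (powerModel n) z).source :=
      ⟨by rwa [extChartAt_source], mem_extChartAt_source z⟩
    have e2 : g z ∈ (extChartAt (powerModel n) (g z)).source ∩
        (extChartAt (powerModel n) (g y)).source :=
      ⟨mem_extChartAt_source (g z), by rwa [extChartAt_source]⟩
    refine ⟨tangentCoordChange 𝓘(ℂ, ℂ) (g z i) (g y i) (g z i) 1 *
      tangentCoordChange 𝓘(ℂ, ℂ) (y j) (z j) (z j) 1, mul_ne_zero ?_ ?_, ?_⟩
    · refine tangentCoordChange_curve_ne_zero ?_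
      rw [extChartAt_power_source, extChartAt_power_source] at e2
      exact ⟨e2.1 i trivial, e2.2 i trivial⟩
    · refine tangentCoordChange_curve_ne_zero ?_
      rw [extChartAt_power_source, extChartAt_power_source] at e1
      exact ⟨e1.1 j trivial, e1.2 j trivial⟩
    · refine (congrArg (fun L : (Fin n → ℂ) →L[ℂ] (Fin n → ℂ) => L (Pi.single j 1) i)
        (inTangentCoordinates_eq (I := powerModel n) (I' := powerModel n) id g
          (fun z => mfderiv (powerModel n) (powerModel n) g z) hz1 hz2)).trans ?_
      have f1 : tangentCoordChange (powerModel n) y z z (Pi.single j 1) =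
          tangentCoordChange 𝓘(ℂ, ℂ) (y j) (z j) (z j) 1 • (Pi.single j 1 : Fin n → ℂ) := by
        funext k
        rw [tangentCoordChange_power e1, Pi.smul_apply]
        by_cases hk : k = j
        · subst hk; simp
        · simp [Pi.single_eq_of_ne hk]
      let L : (Fin n → ℂ) →L[ℂ] (Fin n → ℂ) := mfderiv (powerModel n) (powerModel n) g z
      change tangentCoordChange (powerModel n) (g z) (g y) (g z)
        (L (tangentCoordChange (powerModel n) y z z (Pi.single j 1))) i =
        _ * _ * L (Pi.single j 1) i
      rw [f1, tangentCoordChange_power e2, map_smul, tangentCoordChange_curve_apply,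
        Pi.smul_apply, smul_eq_mul, mul_assoc]
  have h5 : ∀ᶠ z in 𝓝 y, inTangentCoordinates (powerModel n) (powerModel n) id g
      (fun z => mfderiv (powerModel n) (powerModel n) g z) y z (Pi.single j 1) i ≠ 0 := by
    refine h2.eventually_ne ?_
    obtain ⟨c, hc, hc'⟩ := h4 y h3.self_of_nhds
    rw [hc']
    exact mul_ne_zero hc hy
  filter_upwards [h3, h5] with z hz hz'
  obtain ⟨c, -, hc'⟩ := h4 z hz
  rw [hc'] at hz'
  exact right_ne_zero_of_mul hz'

/-- The coordinates other than `j` are changed one at a time; along each such copy of `C` the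
component has zero derivative, hence is constant. -/
theorem apply_eq_of_jacobian_eq_zero [PreconnectedSpace C] {g : (Fin n → C) → (Fin n → C)}
    (hg : MDifferentiable (powerModel n) (powerModel n) g) {i j : Fin n}
    (h : ∀ y, ∀ l ≠ j, jacobian g y i l = 0) {y y' : Fin n → C} (hy : y j = y' j) :
    g y i = g y' i := by
  have hupd : ∀ (z : Fin n → C) (l : Fin n), l ≠ j → ∀ a : C, g (Function.update z l a) i = g z i := by
    intro z l hl a
    have hd : MDifferentiable 𝓘(ℂ, ℂ) 𝓘(ℂ, ℂ) (fun ξ => g (Function.update z l ξ) i) := fun ξ =>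
      (hasMFDerivAt_power_eval _ i).mdifferentiableAt.comp ξ
        ((hg _).comp ξ (((contMDiff_update (m := ω) z l) ξ).mdifferentiableAt (by simp)))
    have h1 := eq_of_mfderiv_eq_zero hd (fun ξ => by
      refine ContinuousLinearMap.ext_ring (R₁ := ℂ) (M₁ := ℂ) ?_
      exact (jacobian_eq_mfderiv hg z i l ξ).symm.trans (h _ l hl)) a (z l)
    simpa using h1
  have hs : ∀ s : Finset (Fin n), j ∉ s → g (s.piecewise y' y) i = g y i := by
    intro s
    induction s using Finset.induction_on with
    | empty => simp
    | insert l s hl ih =>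
      intro hj
      rw [Finset.mem_insert, not_or] at hj
      rw [Finset.piecewise_insert, hupd _ _ (Ne.symm hj.1), ih hj.2]
  rw [← hs (Finset.univ.erase j) (by simp)]
  congr 1
  funext k
  by_cases hk : k = j
  · subst hk; simp [hy]
  · rw [Finset.piecewise_eq_of_mem _ _ _ (by simp [hk])]

/-- A biholomorphism of `Cⁿ` each of whose components has, at every point, at most one nonzero
partial derivative permutes the factors. -/
theorem exists_inducesPermutation [ConnectedSpace (Fin n → C)] [PreconnectedSpace C]
    (g : (Fin n → C) ≃ₘ^ω⟮powerModel n, powerModel n⟯ (Fin n → C))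
    (h : ∀ y i, ∃ j, ∀ l ≠ j, jacobian g y i l = 0) : ∃ σ, InducesPermutation g σ := by
  obtain ⟨y₀⟩ : Nonempty (Fin n → C) := inferInstance
  have hgd : MDifferentiable (powerModel n) (powerModel n) g := g.mdifferentiable (by simp)
  have hgd' : MDifferentiable (powerModel n) (powerModel n) g.symm := g.symm.mdifferentiable (by simp)
  have hne : ∀ y i, ∃ j, jacobian g y i j ≠ 0 ∧ ∀ l ≠ j, jacobian g y i l = 0 := by
    intro y i
    obtain ⟨j, hj⟩ := h y i
    refine ⟨j, fun h0 => ?_, hj⟩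
    have h1 := sum_jacobian_mul_jacobian_symm g y i i
    rw [if_pos rfl, Finset.sum_eq_zero] at h1
    · exact zero_ne_one h1
    · intro l _
      by_cases hl : l = j
      · rw [hl, h0, zero_mul]
      · rw [hj l hl, zero_mul]
  have hconst : ∀ i, ∃ j, ∀ y, jacobian g y i j ≠ 0 ∧ ∀ l ≠ j, jacobian g y i l = 0 := by
    intro i
    obtain ⟨j, hj, -⟩ := hne y₀ i
    -- Every row has exactly one nonzero entry, so the complement is the union of the corresponding
    -- open sets for the other columns.
    have hcl : IsClopen {y | jacobian g y i j ≠ 0} := by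
      refine ⟨⟨?_⟩, isOpen_jacobian_ne_zero g.contMDiff_toFun i j⟩
      have : {y | jacobian g y i j ≠ 0}ᶜ = ⋃ l, ⋃ (_ : l ≠ j), {y | jacobian g y i l ≠ 0} := by
        ext y
        simp only [Set.mem_compl_iff, Set.mem_ofPred_eq, not_not, Set.mem_iUnion, exists_prop]
        obtain ⟨k, hk, hk'⟩ := hne y i
        constructor
        · intro h0
          exact ⟨k, fun e => hk (e ▸ h0), hk⟩
        · rintro ⟨l, hl, hl'⟩
          have hlk : l = k := by
            by_contra e
            exact hl' (hk' l e)
          exact hk' j fun e => hl (hlk.trans e.symm)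
      rw [this]
      exact isOpen_iUnion fun l => isOpen_iUnion fun _ => isOpen_jacobian_ne_zero g.contMDiff_toFun i l
    have hu := hcl.eq_univ ⟨y₀, hj⟩
    refine ⟨j, fun y => ?_⟩
    have hy : jacobian g y i j ≠ 0 := (Set.eq_univ_iff_forall.1 hu) y
    refine ⟨hy, fun l hl => ?_⟩
    obtain ⟨k, -, hk'⟩ := hne y i
    have hjk : j = k := by
      by_contra e
      exact hy (hk' j e)
    exact hk' l (hjk ▸ hl)
  choose s hs hs' using hconst
  have hAB : ∀ y i k, jacobian g y i (s i) * jacobian g.symm (g y) (s i) k =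
      if i = k then 1 else 0 := by
    intro y i k
    rw [← sum_jacobian_mul_jacobian_symm g y i k, Finset.sum_eq_single (s i)
      (fun l _ hl => by rw [hs' i y l hl, zero_mul]) fun h => absurd (Finset.mem_univ _) h]
  have hinj : Function.Injective s := by
    intro i i' hii
    by_contra hne'
    have h1 := hAB y₀ i i
    have h2 := hAB y₀ i' i
    rw [if_neg (Ne.symm hne'), ← hii] at h2
    rcases mul_eq_zero.1 h2 with h3 | h3
    · exact hs i' y₀ (hii ▸ h3)
    · rw [h3, mul_zero, if_pos rfl] at h1
      exact zero_ne_one h1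
  let σ : Equiv.Perm (Fin n) := Equiv.ofBijective s (Finite.injective_iff_bijective.1 hinj)
  have hdep : ∀ i (y y' : Fin n → C), y (s i) = y' (s i) → g y i = g y' i := fun i y y' hy =>
    apply_eq_of_jacobian_eq_zero hgd (fun y => hs' i y) hy
  -- By `hAB`, row `s i` of the inverse Jacobian is supported in column `i`.
  have hdep' : ∀ i (y y' : Fin n → C), y i = y' i → g.symm y (s i) = g.symm y' (s i) := by
    intro i y y' hy
    refine apply_eq_of_jacobian_eq_zero hgd' (fun z l hl => ?_) hy
    have h1 := hAB (g.symm z) i l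
    rw [g.apply_symm_apply, if_neg (Ne.symm hl)] at h1
    exact (mul_eq_zero.1 h1).resolve_left (hs i _)
  -- `h i` is `g` restricted to a coordinate line through `y₀`; by `hdep` and `hdep'` the other
  -- coordinates do not matter.
  refine ⟨σ, fun i =>
    { toFun := fun ζ => g (Function.update y₀ (s i) ζ) i
      invFun := fun ζ => g.symm (Function.update y₀ i ζ) (s i)
      left_inv := fun ζ => ?_
      right_inv := fun ζ => ?_
      contMDiff_toFun := ?_
      contMDiff_invFun := ?_ }, fun y i => ?_⟩
  · have h1 := hdep' i (Function.update y₀ i (g (Function.update y₀ (s i) ζ) i))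
      (g (Function.update y₀ (s i) ζ)) (by simp)
    simp only [h1, g.symm_apply_apply, Function.update_self]
  · have h1 := hdep i (Function.update y₀ (s i) (g.symm (Function.update y₀ i ζ) (s i)))
      (g.symm (Function.update y₀ i ζ)) (by simp)
    simp only [h1, g.apply_symm_apply, Function.update_self]
  · exact (contMDiff_power_eval i).comp (g.contMDiff_toFun.comp (contMDiff_update y₀ (s i)))
  · exact (contMDiff_power_eval (s i)).comp (g.symm.contMDiff_toFun.comp (contMDiff_update y₀ i))
  · exact hdep i _ _ (Function.update_self (s i) (y (s i)) y₀).symm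

end Monomial

/-! ### Automorphisms of powers of the half-plane, by Schwarz–Pick -/

section UpperHalfPlaneAutomorphisms

open UpperHalfPlane ComplexConjugate

namespace UpperHalfPlane

theorem hasMFDerivAt_coe (τ : ℍ) :
    HasMFDerivAt 𝓘(ℂ, ℂ) 𝓘(ℂ, ℂ) ((↑) : ℍ → ℂ) τ (ContinuousLinearMap.id ℂ ℂ) := by
  refine ⟨continuous_coe.continuousAt, ?_⟩
  refine HasFDerivAt.hasFDerivWithinAt ?_
  exact (hasFDerivAt_id (τ : ℂ)).congr_of_eventuallyEq (eventuallyEq_coe_comp_ofComplex τ.im_pos)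

theorem hasMFDerivAt_ofComplex {z : ℂ} (hz : 0 < z.im) :
    HasMFDerivAt 𝓘(ℂ, ℂ) 𝓘(ℂ, ℂ) (ofComplex : ℂ → ℍ) z (ContinuousLinearMap.id ℂ ℂ) := by
  refine ⟨(contMDiffAt_ofComplex (n := ω) hz).continuousAt, ?_⟩
  refine HasFDerivAt.hasFDerivWithinAt ?_
  exact (hasFDerivAt_id z).congr_of_eventuallyEq (eventuallyEq_coe_comp_ofComplex hz)

/-- The disc map sending `0` to `y`. -/
noncomputable def discMap (y u ζ : ℂ) : ℂ := (y - conj y * (u * ζ)) / (1 - u * ζ)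

theorem one_sub_ne_zero {u ζ : ℂ} (hu : ‖u‖ ≤ 1) (hζ : ‖ζ‖ < 1) : 1 - u * ζ ≠ 0 := by
  intro h
  have h1 : ‖u * ζ‖ < 1 := by
    rw [norm_mul]
    nlinarith [norm_nonneg u, norm_nonneg ζ]
  rw [← sub_eq_zero.1 h, norm_one] at h1
  exact lt_irrefl _ h1

theorem discMap_im_pos {y u ζ : ℂ} (hy : 0 < y.im) (hu : ‖u‖ ≤ 1) (hζ : ‖ζ‖ < 1) :
    0 < (discMap y u ζ).im := by
  have hne := one_sub_ne_zero hu hζ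
  have h1 : ‖u * ζ‖ < 1 := by
    rw [norm_mul]
    nlinarith [norm_nonneg u, norm_nonneg ζ]
  set t := u * ζ with ht
  have h2 : (discMap y u ζ).im = y.im * (1 - ‖t‖ ^ 2) / Complex.normSq (1 - t) := by
    rw [discMap, ← ht, Complex.div_im, ← sub_div, ← Complex.normSq_eq_norm_sq, Complex.normSq_apply t]
    congr 1
    simp
    ring
  rw [h2]
  have h3 : 0 < Complex.normSq (1 - t) := Complex.normSq_pos.2 hne
  have h4 : 0 < 1 - ‖t‖ ^ 2 := by nlinarith [norm_nonneg t]
  positivity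

theorem discMap_zero (y u : ℂ) : discMap y u 0 = y := by simp [discMap]

theorem differentiableAt_discMap {y u ζ : ℂ} (hu : ‖u‖ ≤ 1) (hζ : ‖ζ‖ < 1) :
    DifferentiableAt ℂ (discMap y u) ζ :=
  DifferentiableAt.div (by fun_prop) (by fun_prop) (one_sub_ne_zero hu hζ)

theorem hasDerivAt_discMap_zero (y u : ℂ) :
    HasDerivAt (discMap y u) (2 * Complex.I * y.im * u) 0 := by
  have h1 : HasDerivAt (fun ζ : ℂ => u * ζ) u 0 := by
    simpa using (hasDerivAt_id (0 : ℂ)).const_mul u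
  have h2 := ((h1.const_mul (conj y)).const_sub y).div (h1.const_sub 1) (by simp)
  refine h2.congr_deriv ?_
  have h3 : y - conj y = 2 * Complex.I * y.im := by
    rw [Complex.sub_conj]; push_cast; ring
  simp only [mul_zero, sub_zero, mul_one, one_pow, div_one]
  rw [← h3]
  ring

theorem norm_cayley_le_one {w w₀ : ℂ} (hw : 0 < w.im) (hw₀ : 0 < w₀.im) :
    ‖(w - w₀) / (w - conj w₀)‖ ≤ 1 := by
  rw [norm_div]
  refine div_le_one_of_le₀ ?_ (norm_nonneg _)
  rw [← sq_le_sq₀ (norm_nonneg _) (norm_nonneg _), ← Complex.normSq_eq_norm_sq,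
    ← Complex.normSq_eq_norm_sq, Complex.normSq_apply, Complex.normSq_apply]
  simp
  nlinarith [mul_pos hw hw₀]

variable {n : ℕ}

/-- The Schwarz–Pick inequality for holomorphic maps `ℍⁿ → ℍ`. -/
theorem sum_norm_jacobian_mul_im_le {g : (Fin n → ℍ) → (Fin n → ℍ)}
    (hg : MDifferentiable (powerModel n) (powerModel n) g) (y : Fin n → ℍ) (i : Fin n) :
    ∑ j, ‖jacobian g y i j‖ * (y j).im ≤ (g y i).im := by
  -- The phases make all terms of the derivative of `g i` along the disc add up without
  -- cancellation; where the entry vanishes, `u j = 0`.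
  let u : Fin n → ℂ := fun j => conj (jacobian g y i j) / ‖jacobian g y i j‖
  have hu : ∀ j, ‖u j‖ ≤ 1 := fun j => by
    simp only [u, norm_div, RCLike.norm_conj, Complex.norm_real, norm_norm]
    exact div_self_le_one _
  have hAu : ∀ j, jacobian g y i j * u j = ‖jacobian g y i j‖ := fun j => by
    by_cases h0 : jacobian g y i j = 0
    · simp [h0]
    · have : (‖jacobian g y i j‖ : ℂ) ≠ 0 := by simpa using h0
      simp only [u]
      rw [← mul_div_assoc, Complex.mul_conj, Complex.normSq_eq_norm_sq]
      push_cast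
      field_simp
  let φ : ℂ → Fin n → ℍ := fun ζ j => ofComplex (discMap (y j) (u j) ζ)
  have hφi : ∀ ζ : ℂ, ‖ζ‖ < 1 → ∀ j, MDifferentiableAt 𝓘(ℂ, ℂ) 𝓘(ℂ, ℂ) (fun ζ => φ ζ j) ζ :=
    fun ζ hζ j =>
      (mdifferentiableAt_ofComplex (discMap_im_pos (y j).im_pos (hu j) hζ)).comp ζ
        (differentiableAt_discMap (hu j) hζ).mdifferentiableAt
  have hφ : ∀ ζ : ℂ, ‖ζ‖ < 1 → MDifferentiableAt 𝓘(ℂ, ℂ) (powerModel n) φ ζ := fun ζ hζ =>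
    mdifferentiableAt_power (hφi ζ hζ)
  have hφ0 : φ 0 = y := by
    funext j
    simp only [φ, discMap_zero, ofComplex_apply]
  have hφ' : ∀ j, (mfderiv 𝓘(ℂ, ℂ) (powerModel n) φ (0 : ℂ) (1 : ℂ) : Fin n → ℂ) j =
      2 * Complex.I * (y j).im * u j := by
    intro j
    refine (mfderiv_power_apply (hφ 0 (by simp)) (1 : ℂ) j).trans ?_
    have h1 : HasMFDerivAt 𝓘(ℂ, ℂ) 𝓘(ℂ, ℂ) (ofComplex : ℂ → ℍ) (discMap (y j) (u j) 0)
        (ContinuousLinearMap.id ℂ ℂ) :=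
      hasMFDerivAt_ofComplex (by rw [discMap_zero]; exact (y j).im_pos)
    have h2 := h1.comp 0 (hasDerivAt_discMap_zero (y j) (u j)).hasFDerivAt.hasMFDerivAt
    refine (congrArg (fun L : ℂ →L[ℂ] ℂ => L 1) h2.mfderiv).trans ?_
    exact one_smul ℂ _
  let G : ℂ → ℂ := fun ζ => (g (φ ζ) i : ℂ)
  have hGm : ∀ ζ : ℂ, ‖ζ‖ < 1 → HasMFDerivAt 𝓘(ℂ, ℂ) 𝓘(ℂ, ℂ) G ζ
      ((ContinuousLinearMap.id ℂ ℂ).comp ((ContinuousLinearMap.proj (R := ℂ)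
        (φ := fun _ : Fin n => ℂ) i).comp ((mfderiv (powerModel n) (powerModel n) g (φ ζ)).comp
          (mfderiv 𝓘(ℂ, ℂ) (powerModel n) φ ζ)))) := fun ζ hζ =>
    (hasMFDerivAt_coe (g (φ ζ) i)).comp ζ ((hasMFDerivAt_power_eval (g (φ ζ)) i).comp ζ
      ((hg (φ ζ)).hasMFDerivAt.comp ζ (hφ ζ hζ).hasMFDerivAt))
  have hGd : ∀ ζ : ℂ, ‖ζ‖ < 1 → DifferentiableAt ℂ G ζ := fun ζ hζ =>
    (hGm ζ hζ).mdifferentiableAt.differentiableAt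
  have hG0 : G 0 = g y i := by simp only [G, hφ0]
  have hG' : HasDerivAt G (2 * Complex.I * ∑ j, (‖jacobian g y i j‖ * (y j).im : ℝ)) 0 := by
    let dφ : ℂ →L[ℂ] (Fin n → ℂ) := mfderiv 𝓘(ℂ, ℂ) (powerModel n) φ (0 : ℂ)
    let dg : (Fin n → ℂ) →L[ℂ] (Fin n → ℂ) := mfderiv (powerModel n) (powerModel n) g (φ 0)
    have h1 : HasFDerivAt G ((ContinuousLinearMap.id ℂ ℂ).comp ((ContinuousLinearMap.proj (R := ℂ)
        (φ := fun _ : Fin n => ℂ) i).comp (dg.comp dφ))) 0 :=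
      hasMFDerivAt_iff_hasFDerivAt.1 (hGm 0 (by simp))
    refine h1.hasDerivAt.congr_deriv ?_
    have h2 := mfderiv_eq_sum_jacobian g (φ 0) (mfderiv 𝓘(ℂ, ℂ) (powerModel n) φ (0 : ℂ) (1 : ℂ)) i
    refine Eq.trans h2 ?_
    rw [Complex.ofReal_sum, Finset.mul_sum]
    refine Finset.sum_congr rfl fun j _ => ?_
    rw [hφ' j, hφ0]
    push_cast
    rw [← hAu j]
    ring
  let w₀ : ℂ := g y i
  have hw₀ : 0 < w₀.im := (g y i).im_pos
  have hden : ∀ ζ, G ζ - conj w₀ ≠ 0 := fun ζ h => by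
    have h1 := congrArg Complex.im h
    have h2 : 0 < (G ζ).im := (g (φ ζ) i).im_pos
    simp at h1
    linarith
  -- The Cayley transform at `w₀ = G 0` gives a self-map of the disc fixing `0`; the Schwarz bound
  -- on its derivative there is the claim.
  let F : ℂ → ℂ := fun ζ => (G ζ - w₀) / (G ζ - conj w₀)
  have hF0 : F 0 = 0 := by simp [F, hG0, w₀]
  have hFd : DifferentiableOn ℂ F (Metric.ball 0 1) := fun ζ hζ => by
    have hd := hGd ζ (by simpa using hζ)
    exact ((hd.sub_const _).div (hd.sub_const _) (hden ζ)).differentiableWithinAt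
  have hFm : Set.MapsTo F (Metric.ball 0 1) (Metric.closedBall (F 0) 1) := fun ζ _ => by
    rw [hF0, mem_closedBall_zero_iff]
    exact norm_cayley_le_one (g (φ ζ) i).im_pos hw₀
  have hF' := Complex.norm_deriv_le_one_of_mapsTo_ball hFd hFm one_pos
  have hFder := ((hG'.sub_const w₀).div (hG'.sub_const (conj w₀)) (hden 0)).deriv
  have h3 : w₀ - conj w₀ = 2 * Complex.I * (w₀.im : ℂ) := by
    rw [Complex.sub_conj]; push_cast; ring
  have hw₀' : (w₀.im : ℂ) ≠ 0 := by exact_mod_cast hw₀.ne'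
  have hFval : deriv F 0 = ((∑ j, ‖jacobian g y i j‖ * (y j).im) / w₀.im : ℝ) := by
    refine Eq.trans hFder ?_
    rw [hG0]
    change (_ * (w₀ - conj w₀) - (w₀ - w₀) * _) / (w₀ - conj w₀) ^ 2 = _
    rw [h3]
    have := Complex.I_ne_zero
    push_cast
    field_simp
    ring
  rw [hFval, Complex.norm_real, Real.norm_of_nonneg (div_nonneg
    (Finset.sum_nonneg fun j _ => mul_nonneg (norm_nonneg _) (y j).im_pos.le) hw₀.le),
    div_le_one hw₀] at hF'
  exact hF'

end UpperHalfPlane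

variable {n : ℕ}

/-- `M` and `N` are the absolute Jacobian entries of `g` and `g⁻¹` measured in the metrics `|dz| /
Im z`. Their row sums are at most one, while `N * M` has diagonal entries at least one. -/
theorem exists_jacobian_eq_zero_upperHalfPlane
    (g : (Fin n → ℍ) ≃ₘ^ω⟮powerModel n, powerModel n⟯ (Fin n → ℍ)) (y : Fin n → ℍ) (i : Fin n) :
    ∃ j, ∀ l ≠ j, jacobian g y i l = 0 := by
  have hM := UpperHalfPlane.sum_norm_jacobian_mul_im_le (g.mdifferentiable (by simp)) y
  have hN := UpperHalfPlane.sum_norm_jacobian_mul_im_le (g.symm.mdifferentiable (by simp)) (g y)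
  have hMN := sum_jacobian_mul_jacobian_symm g.symm (g y)
  simp only [g.symm_apply_apply] at hN
  rw [g.symm_apply_apply] at hMN
  let M : Fin n → Fin n → ℝ := fun i j => ‖jacobian g y i j‖ * (y j).im / (g y i).im
  let N : Fin n → Fin n → ℝ := fun j i => ‖jacobian g.symm (g y) j i‖ * (g y i).im / (y j).im
  have hM0 : ∀ i j, 0 ≤ M i j := fun i j => by
    have := (y j).im_pos; have := (g y i).im_pos; positivity
  have hN0 : ∀ i j, 0 ≤ N i j := fun i j => by
    have := (y i).im_pos; have := (g y j).im_pos; positivity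
  have hM1 : ∀ i, ∑ j, M i j ≤ 1 := fun i => by
    rw [← Finset.sum_div, div_le_one (g y i).im_pos]; exact hM i
  have hN1 : ∀ j, ∑ i, N j i ≤ 1 := fun j => by
    rw [← Finset.sum_div, div_le_one (y j).im_pos]; exact hN j
  have hprod : ∀ j, 1 ≤ ∑ i, N j i * M i j := fun j => by
    have h1 := hMN j j
    rw [if_pos rfl] at h1
    calc (1 : ℝ) = ‖∑ i, jacobian g.symm (g y) j i * jacobian g y i j‖ := by
          refine Eq.trans ?_ (congrArg norm h1).symm
          simp
      _ ≤ ∑ i, ‖jacobian g.symm (g y) j i * jacobian g y i j‖ := norm_sum_le _ _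
      _ = ∑ i, N j i * M i j := Finset.sum_congr rfl fun i _ => by
          have h2 := (y j).im_pos.ne'
          have h3 := (g y i).im_pos.ne'
          simp only [N, M, norm_mul]
          field_simp
  -- A combination of numbers below one, with nonnegative weights of total at most one, cannot reach
  -- one.
  have hex : ∀ j, ∃ i, 1 ≤ M i j := fun j => by
    by_contra! hlt
    have h1 : ∑ i, N j i * (1 - M i j) ≤ 0 := by
      simp only [mul_sub, mul_one, Finset.sum_sub_distrib]
      linarith [hN1 j, hprod j]
    have h2 : ∀ i ∈ Finset.univ, 0 ≤ N j i * (1 - M i j) := fun i _ =>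
      mul_nonneg (hN0 j i) (by linarith [hlt i])
    have h3 := (Finset.sum_eq_zero_iff_of_nonneg h2).1 (le_antisymm h1 (Finset.sum_nonneg h2))
    have h4 : ∑ i, N j i * M i j = 0 := Finset.sum_eq_zero fun i hi => by
      have h5 := (mul_eq_zero.1 (h3 i hi)).resolve_right (by linarith [hlt i])
      rw [h5, zero_mul]
    linarith [hprod j]
  choose r hr using hex
  -- The entry in column `j` already exhausts the row sum.
  have hzero : ∀ j, ∀ l ≠ j, M (r j) l = 0 := fun j l hl => by
    have h1 : M (r j) l + M (r j) j ≤ ∑ k, M (r j) k := by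
      rw [← Finset.sum_pair hl]
      exact Finset.sum_le_sum_of_subset_of_nonneg (Finset.subset_univ _) fun k _ _ => hM0 _ k
    linarith [hM1 (r j), hr j, hM0 (r j) l]
  have hinj : Function.Injective r := fun j j' h => by
    by_contra hne
    have h1 := hzero j j' (Ne.symm hne)
    rw [h] at h1
    linarith [hr j']
  obtain ⟨j, rfl⟩ := Finite.injective_iff_surjective.1 hinj i
  refine ⟨j, fun l hl => ?_⟩
  have h1 := hzero j l hl
  simpa [M, (y l).im_pos.ne', (g y (r j)).im_pos.ne'] using h1

end UpperHalfPlaneAutomorphisms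

/-! ### Automorphisms of powers of the sphere, by absence of one-forms -/

namespace RiemannSphere

theorem extChartAt_coe (z : ℂ) :
    extChartAt 𝓘(ℂ, ℂ) ((z : OnePoint ℂ) : RiemannSphere) =
      affineChart.toPartialEquiv := by
  have : chartAt ℂ ((z : OnePoint ℂ) : RiemannSphere) = affineChart :=
    if_neg (OnePoint.coe_ne_infty z)
  simp [extChartAt, this]

theorem extChartAt_infty :
    extChartAt 𝓘(ℂ, ℂ) (OnePoint.infty : RiemannSphere) = inftyChart.toPartialEquiv := by
  have : chartAt ℂ (OnePoint.infty : RiemannSphere) = inftyChart := if_pos rfl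
  simp [extChartAt, this]

/-- The inverse of the preferred chart at infinity. -/
noncomputable def inftyParam (z : ℂ) : RiemannSphere := inversion (z : OnePoint ℂ)

theorem contMDiff_coe : ContMDiff 𝓘(ℂ, ℂ) 𝓘(ℂ, ℂ) ω ((↑) : ℂ → RiemannSphere) := by
  have h := contMDiffOn_extChartAt_symm (I := 𝓘(ℂ, ℂ)) (n := ω) ((0 : ℂ) : RiemannSphere)
  rw [extChartAt_coe, show (affineChart.toPartialEquiv).target = Set.univ by simp [affineChart],
    contMDiffOn_univ] at h
  exact h

theorem contMDiff_inftyParam : ContMDiff 𝓘(ℂ, ℂ) 𝓘(ℂ, ℂ) ω inftyParam := by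
  have h := contMDiffOn_extChartAt_symm (I := 𝓘(ℂ, ℂ)) (n := ω) (OnePoint.infty : RiemannSphere)
  rw [extChartAt_infty, show (inftyChart.toPartialEquiv).target = Set.univ by
    simp [inftyChart, affineChart], contMDiffOn_univ] at h
  exact h

/-- A holomorphic `1`-form `F(z) dz` on `ℂ` that extends holomorphically to infinity vanishes. -/
theorem eq_zero_of_extends_to_infty {F F' : ℂ → ℂ} (hF : Differentiable ℂ F)
    (hF' : ContinuousAt F' 0) (h : ∀ z ≠ 0, F z = -(z ^ 2)⁻¹ * F' z⁻¹) : F = 0 := by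
  have h1 : Tendsto F (cocompact ℂ) (𝓝 0) := by
    rw [← Metric.cobounded_eq_cocompact]
    have hinv : Tendsto (fun z : ℂ => z⁻¹) (Bornology.cobounded ℂ) (𝓝 0) :=
      tendsto_inv₀_cobounded
    have h2 : Tendsto (fun z : ℂ => -(z⁻¹ ^ 2) * F' z⁻¹) (Bornology.cobounded ℂ)
        (𝓝 (-(0 ^ 2) * F' 0)) :=
      ((hinv.pow 2).neg).mul (hF'.tendsto.comp hinv)
    have h3 : (-(0 ^ 2) * F' 0 : ℂ) = 0 := by simp
    rw [h3] at h2
    refine h2.congr' ?_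
    filter_upwards [Bornology.eventually_ne_cobounded (0 : ℂ)] with z hz
    rw [h z hz, inv_pow]
  funext z
  exact hF.apply_eq_of_tendsto_cocompact z h1

/-- On the diagonal `G` takes the single value `c`, so its partial derivative in the second variable
there is a holomorphic one-form on `ℙ¹` with values in the fixed line `T_c ℙ¹`, hence zero. -/
theorem mfderiv_eq_zero_of_const_on_diagonal {G : RiemannSphere × RiemannSphere → RiemannSphere}
    (hG : ContMDiff (𝓘(ℂ, ℂ).prod 𝓘(ℂ, ℂ)) 𝓘(ℂ, ℂ) ω G) {c : RiemannSphere}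
    (hc : ∀ ζ, G (ζ, ζ) = c) (ζ : RiemannSphere) :
    mfderiv 𝓘(ℂ, ℂ) 𝓘(ℂ, ℂ) (fun ξ => G (ζ, ξ)) ζ = 0 := by
  set φ := extChartAt 𝓘(ℂ, ℂ) c with hφ
  have hH : ∀ {e : ℂ → RiemannSphere}, ContMDiff 𝓘(ℂ, ℂ) 𝓘(ℂ, ℂ) ω e → ∀ s : ℂ,
      ContDiffAt ℂ ω (fun p : ℂ × ℂ => φ (G (e p.1, e p.2))) (s, s) := by
    intro e he s
    have h1 : ContMDiffAt (𝓘(ℂ, ℂ).prod 𝓘(ℂ, ℂ)) 𝓘(ℂ, ℂ) ω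
        (fun p : ℂ × ℂ => φ (G (e p.1, e p.2))) (s, s) := by
      have h2 : ContMDiff (𝓘(ℂ, ℂ).prod 𝓘(ℂ, ℂ)) 𝓘(ℂ, ℂ) ω
          (fun p : ℂ × ℂ => G (e p.1, e p.2)) :=
        hG.comp ((he.comp contMDiff_fst).prodMk (he.comp contMDiff_snd))
      have h3 : ContMDiffAt 𝓘(ℂ, ℂ) 𝓘(ℂ, ℂ) ω φ (G (e s, e s)) := by
        rw [hc]; exact contMDiffAt_extChartAt
      exact ContMDiffAt.comp (s, s) h3 (h2 (s, s))
    rw [← modelWithCornersSelf_prod, chartedSpaceSelf_prod] at h1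
    exact h1.contDiffAt
  have hpart : ∀ {e : ℂ → RiemannSphere}, ContMDiff 𝓘(ℂ, ℂ) 𝓘(ℂ, ℂ) ω e → ∀ s : ℂ,
      HasDerivAt (fun t => φ (G (e s, e t)))
        (fderiv ℂ (fun p : ℂ × ℂ => φ (G (e p.1, e p.2))) (s, s) (0, 1)) s := by
    intro e he s
    have h1 := ((hH he s).differentiableAt (by simp)).hasFDerivAt
    exact h1.comp_hasDerivAt s ((hasDerivAt_const s s).prodMk (hasDerivAt_id s))
  have hdiff : ∀ {e : ℂ → RiemannSphere}, ContMDiff 𝓘(ℂ, ℂ) 𝓘(ℂ, ℂ) ω e → ∀ s : ℂ,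
      DifferentiableAt ℂ (fun s => fderiv ℂ (fun p : ℂ × ℂ => φ (G (e p.1, e p.2))) (s, s) (0, 1))
        s := by
    intro e he s
    have h1 : DifferentiableAt ℂ (fderiv ℂ (fun p : ℂ × ℂ => φ (G (e p.1, e p.2)))) (s, s) :=
      ((hH he s).fderiv_right (m := ω) le_rfl).differentiableAt (by simp)
    have h2 : DifferentiableAt ℂ (fun s : ℂ => (s, s)) s := by fun_prop
    exact (DifferentiableAt.comp (f := fun s : ℂ => (s, s)) s h1 h2).clm_apply (differentiableAt_const _)
  -- `F₀` and `F₁` are the coefficients of this one-form in the charts `z` and `1 / z`.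
  let F₀ : ℂ → ℂ := fun s =>
    fderiv ℂ (fun p : ℂ × ℂ => φ (G ((p.1 : OnePoint ℂ), (p.2 : OnePoint ℂ)))) (s, s) (0, 1)
  let F₁ : ℂ → ℂ := fun s =>
    fderiv ℂ (fun p : ℂ × ℂ => φ (G (inftyParam p.1, inftyParam p.2))) (s, s) (0, 1)
  have hF₀ : Differentiable ℂ F₀ := hdiff contMDiff_coe
  have hF₁ : Differentiable ℂ F₁ := hdiff contMDiff_inftyParam
  have hrel : ∀ z ≠ 0, F₀ z = -(z ^ 2)⁻¹ * F₁ z⁻¹ := by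
    intro z hz
    have h1 : HasDerivAt (fun t => φ (G (inftyParam z⁻¹, inftyParam t))) (F₁ z⁻¹) z⁻¹ :=
      hpart contMDiff_inftyParam z⁻¹
    have h2 := h1.comp z (hasDerivAt_inv hz)
    have h3 : HasDerivAt (fun t : ℂ => φ (G ((z : OnePoint ℂ), (t : OnePoint ℂ)))) (F₀ z) z :=
      hpart contMDiff_coe z
    have h4 : (fun t : ℂ => φ (G ((z : OnePoint ℂ), (t : OnePoint ℂ)))) =ᶠ[𝓝 z]
        (fun t => φ (G (inftyParam z⁻¹, inftyParam t))) ∘ Inv.inv := by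
      filter_upwards [isOpen_ne.mem_nhds hz] with t ht
      simp only [Function.comp_apply, inftyParam, inversion_coe (inv_ne_zero hz),
        inversion_coe (inv_ne_zero ht), inv_inv]
    rw [h3.unique (h2.congr_of_eventuallyEq h4), mul_comm]
  have hF₀0 : F₀ = 0 := eq_zero_of_extends_to_infty hF₀ (hF₁ 0).continuousAt hrel
  -- The relation `hrel` does not reach the point at infinity; continuity does.
  have hF₁0 : F₁ 0 = 0 := by
    have h1 : ∀ s ≠ 0, F₁ s = 0 := fun s hs => by
      have h2 := hrel s⁻¹ (inv_ne_zero hs)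
      rw [hF₀0, inv_inv, Pi.zero_apply, eq_comm] at h2
      exact (mul_eq_zero.1 h2).resolve_left (by simpa using hs)
    have h3 : Tendsto F₁ (𝓝[≠] 0) (𝓝 (F₁ 0)) := (hF₁ 0).continuousAt.tendsto.mono_left inf_le_left
    refine tendsto_nhds_unique h3 (tendsto_const_nhds.congr' ?_)
    filter_upwards [self_mem_nhdsWithin] with s hs
    exact (h1 s hs).symm
  have hd : MDifferentiableAt 𝓘(ℂ, ℂ) 𝓘(ℂ, ℂ) (fun ξ => G (ζ, ξ)) ζ :=
    (hG.comp (contMDiff_const.prodMk contMDiff_id)).mdifferentiableAt (by simp)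
  rw [hd.mfderiv]
  simp only [modelWithCornersSelf_coe, Set.range_id, fderivWithin_univ, writtenInExtChartAt, hc]
  rw [← hφ]
  induction ζ using OnePoint.rec with
  | infty =>
    rw [extChartAt_infty]
    have h0 : inftyChart (OnePoint.infty : RiemannSphere) = 0 := by
      rw [inftyChart_apply, inversion_infty, affineChart_coe]
    have h1 := hpart contMDiff_inftyParam 0
    have h2 : inftyParam 0 = OnePoint.infty := inversion_zero
    rw [show fderiv ℂ _ _ _ = F₁ 0 from rfl, hF₁0, h2] at h1
    have h3 := h1.hasFDerivAt.fderiv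
    change fderiv ℂ (fun t => φ (G (OnePoint.infty, inftyParam t))) (inftyChart OnePoint.infty) = 0
    rw [h0, h3]
    ext
    simp
  | coe z =>
    rw [extChartAt_coe]
    have h1 := hpart contMDiff_coe z
    rw [show fderiv ℂ _ _ _ = F₀ z from rfl, hF₀0] at h1
    have h3 := h1.hasFDerivAt.fderiv
    change fderiv ℂ (fun t : ℂ => φ (G ((z : OnePoint ℂ), (t : OnePoint ℂ)))) (affineChart (z : OnePoint ℂ)) = 0
    rw [affineChart_coe, h3]
    ext
    simp

variable {n : ℕ}

/-- Move only coordinate `l` of `w`: to `ζ` when computing `g⁻¹`, but to `ξ` for its `j`-th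
component, then apply `g` and read component `i`. For `ξ = ζ` this is `w i`, a constant since `i ≠
l`; its derivative in `ξ` at `ζ = ξ = w l` is the product in question. -/
theorem jacobian_mul_jacobian_symm_eq_zero
    (g : (Fin n → RiemannSphere) ≃ₘ^ω⟮powerModel n, powerModel n⟯ (Fin n → RiemannSphere))
    (w : Fin n → RiemannSphere) {i l : Fin n} (hil : i ≠ l) (j : Fin n) :
    jacobian g (g.symm w) i j * jacobian g.symm w j l = 0 := by
  let a : RiemannSphere → RiemannSphere := fun ξ => g.symm (Function.update w l ξ) j
  let b : RiemannSphere → RiemannSphere := fun η => g (Function.update (g.symm w) j η) i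
  let G : RiemannSphere × RiemannSphere → RiemannSphere := fun p =>
    g (Function.update (g.symm (Function.update w l p.1)) j (g.symm (Function.update w l p.2) j)) i
  have ha : ContMDiff 𝓘(ℂ, ℂ) 𝓘(ℂ, ℂ) ω a :=
    (contMDiff_power_eval j).comp (g.symm.contMDiff_toFun.comp (contMDiff_update w l))
  have hb : ContMDiff 𝓘(ℂ, ℂ) 𝓘(ℂ, ℂ) ω b :=
    (contMDiff_power_eval i).comp (g.contMDiff_toFun.comp (contMDiff_update (g.symm w) j))
  have hG : ContMDiff (𝓘(ℂ, ℂ).prod 𝓘(ℂ, ℂ)) 𝓘(ℂ, ℂ) ω G := by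
    refine (contMDiff_power_eval i).comp (g.contMDiff_toFun.comp (contMDiff_power fun m => ?_))
    by_cases hm : m = j
    · subst hm
      simp only [Function.update_self]
      exact ha.comp contMDiff_snd
    · simp only [Function.update_of_ne hm]
      exact ((contMDiff_power_eval m).comp
        (g.symm.contMDiff_toFun.comp (contMDiff_update w l))).comp contMDiff_fst
  have hGc : ∀ ζ, G (ζ, ζ) = w i := fun ζ => by
    simp only [G, Function.update_eq_self]
    have : g (g.symm (Function.update w l ζ)) i = Function.update w l ζ i := by
      rw [g.apply_symm_apply]
    rw [this, Function.update_of_ne hil]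
  have h0 := mfderiv_eq_zero_of_const_on_diagonal hG hGc (w l)
  have hGab : (fun ξ => G (w l, ξ)) = b ∘ a := by
    funext ξ
    simp only [G, a, b, Function.update_eq_self, Function.comp_apply]
  have h1 : HasMFDerivAt 𝓘(ℂ, ℂ) 𝓘(ℂ, ℂ) a (w l) _ :=
    (ha.mdifferentiableAt (by simp)).hasMFDerivAt
  have h2 : HasMFDerivAt 𝓘(ℂ, ℂ) 𝓘(ℂ, ℂ) b (a (w l)) _ :=
    (hb.mdifferentiableAt (by simp)).hasMFDerivAt
  let A : ℂ →L[ℂ] ℂ := mfderiv 𝓘(ℂ, ℂ) 𝓘(ℂ, ℂ) a (w l)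
  let B : ℂ →L[ℂ] ℂ := mfderiv 𝓘(ℂ, ℂ) 𝓘(ℂ, ℂ) b (a (w l))
  have h3 : B (A 1) = 0 := by
    have h4 := (h2.comp (w l) h1).mfderiv
    rw [← hGab] at h4
    exact congrArg (fun L : ℂ →L[ℂ] ℂ => L 1) (h4.symm.trans h0)
  have hA : jacobian g.symm w j l = A 1 := by
    have h4 := jacobian_eq_mfderiv (g.symm.mdifferentiable (by simp)) w j l (w l)
    rw [Function.update_eq_self] at h4
    exact h4
  have hB : jacobian g (g.symm w) i j = B 1 := by
    have h4 := jacobian_eq_mfderiv (g.mdifferentiable (by simp)) (g.symm w) i j (a (w l))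
    have h5 : a (w l) = g.symm w j := by simp only [a, Function.update_eq_self]
    have h6 : Function.update (g.symm w) j (a (w l)) = g.symm w := by
      rw [h5, Function.update_eq_self]
    rw [h6] at h4
    exact h4
  rw [hA, hB, mul_comm, ← smul_eq_mul, ← map_smul, smul_eq_mul, mul_one, h3]

/-- Some `j` has both `∂gᵢ/∂yⱼ` and `∂(g⁻¹)ⱼ/∂wᵢ` nonzero, as the diagonal sum is one; the preceding
lemma for `g⁻¹` then kills the rest of row `i`. -/
theorem exists_jacobian_eq_zero
    (g : (Fin n → RiemannSphere) ≃ₘ^ω⟮powerModel n, powerModel n⟯ (Fin n → RiemannSphere))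
    (y : Fin n → RiemannSphere) (i : Fin n) : ∃ j, ∀ l ≠ j, jacobian g y i l = 0 := by
  have h1 := sum_jacobian_mul_jacobian_symm g y i i
  rw [if_pos rfl] at h1
  obtain ⟨j, -, hj⟩ := Finset.exists_ne_zero_of_sum_ne_zero (h1.trans_ne one_ne_zero)
  refine ⟨j, fun l hl => ?_⟩
  have h2 := jacobian_mul_jacobian_symm_eq_zero g.symm y (Ne.symm hl) i
  exact (mul_eq_zero.1 h2).resolve_left (right_ne_zero_of_mul hj)

end RiemannSphere

/-! ### Application to universal covers -/

theorem IsHolomorphicUniversalCover.isPermutingCover {n : ℕ} {C : Type*} [TopologicalSpace C]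
    [ChartedSpace ℂ C] [IsManifold 𝓘(ℂ, ℂ) ω C] [ConnectedSpace C] [Nontrivial C]
    {X Y : Type*} [TopologicalSpace X] [ChartedSpace (Fin n → ℂ) X]
    [TopologicalSpace Y] [ChartedSpace (Fin n → ℂ) Y] {p : Y → X}
    (hp : IsHolomorphicUniversalCover n p)
    (Φ : (Fin n → C) ≃ₘ^ω⟮powerModel n, 𝓘(ℂ, Fin n → ℂ)⟯ Y)
    (h : ∀ (g : (Fin n → C) ≃ₘ^ω⟮powerModel n, powerModel n⟯ (Fin n → C)) y i,
      ∃ j, ∀ l ≠ j, jacobian g y i l = 0) : IsPermutingCover (p ∘ Φ) where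
  simplyConnected := by
    have := hp.simplyConnected
    exact Φ.toHomeomorph.toHomotopyEquiv.simplyConnectedSpace
  nontrivial := inferInstance
  surjective := hp.surjective.comp Φ.surjective
  isCoveringMap := hp.isCoveringMap.comp_homeomorph Φ.toHomeomorph
  isLocalDiffeomorph y := 
    (Φ.isLocalDiffeomorph y).comp _ _ (hp.isLocalDiffeomorph (Φ y))
  permutes g := exists_inducesPermutation g (h g)

theorem proposition1p3 (n : ℕ)
    (X : Type*) [TopologicalSpace X] [T2Space X] [CompactSpace X]
    [ChartedSpace (Fin n → ℂ) X] [IsManifold 𝓘(ℂ, Fin n → ℂ) ω X]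
    (Y : Type*) [TopologicalSpace Y]
    [ChartedSpace (Fin n → ℂ) Y] [IsManifold 𝓘(ℂ, Fin n → ℂ) ω Y]
    (p : Y → X) (hp : IsHolomorphicUniversalCover n p) :
    (∀ Φ : (Fin n → RiemannSphere) ≃ₘ^ω⟮powerModel n, 𝓘(ℂ, Fin n → ℂ)⟯ Y,
      ∃ T : SemispecialTensor n X, T.IsDescendedFromStandard (p ∘ Φ)) ∧
    (∀ Φ : (Fin n → UpperHalfPlane) ≃ₘ^ω⟮powerModel n, 𝓘(ℂ, Fin n → ℂ)⟯ Y,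
      ∃ T : SemispecialTensor n X, T.IsDescendedFromStandard (p ∘ Φ)) := by
  have := hp.simplyConnected
  have : Nonempty X := Nonempty.map p inferInstance
  constructor
  · intro Φ
    have hq := hp.isPermutingCover Φ RiemannSphere.exists_jacobian_eq_zero
    exact ⟨hq.semispecialTensor, hq.isDescendedFromStandard⟩
  · intro Φ
    have hq := hp.isPermutingCover Φ exists_jacobian_eq_zero_upperHalfPlane
    exact ⟨hq.semispecialTensor, hq.isDescendedFromStandard⟩
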